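/- All manifolds are smooth ($C^\infty$) and modelled on real Banach spaces. A weak subbundle of the cotangent bundle $T'M$ of a manifold $M$ modelled on $\mathbb M$ is a Banach bundle $T^\flat M$ with fibres $T^\flat_xM\subset T'_xM$ such that, over suitable charts covering $M$, the inclusion $T^\flat M\to T'M$ is the inclusion $U\times\mathbb M^\flat\to U\times\mathbb M'$ given by a fixed continuous linear injection of a Banach space $\mathbb M^\flat$ into $\mathbb M'$ (the transition maps between these trivialisations of $T^\flat M$ being smooth into $L(\mathbb M^\flat)$). For $U\subset M$ open, $\mathfrak A(U)$ is the set of $f\in C^\infty(U)$ such that $df$ is a smooth section of $T^\flat M$ and $d^k_xf(\cdot,u_2,\dots,u_k)\in T^\flat_xM$ for all $k\ge1$, $x\in U$ and $u_i\in T_xM$ (derivatives being taken in those charts). A partial Poisson anchor is a morphism of Banach bundles $P:T^\flat M\to TM$ with $\langle\xi,P\eta\rangle=-\langle\eta,P\xi\rangle$ such that, for every open $U$, the bracket $\{f,g\}_P=-\langle df,P(dg)\rangle$ maps $\mathfrak A(U)\times\mathfrak A(U)$ into $\mathfrak A(U)$ and satisfies the Jacobi identity; $M$ with $T^\flat M$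 and $P$ is then a partial Poisson manifold. **Theorem.** Let $M$ be a partial Poisson manifold with anchor $P:T^\flat M\to TM$, and let $S=\iota(\check M)$ be an immersed submanifold of $M$, where $\iota:\check M\to M$ is an injective immersion of Banach manifolds. For $V\subset\check M$ open, denote by * $\mathfrak X^\flat(S,M)(V)$ the space of smooth $1$-forms along $\iota|_V$ with values in $T^\flat M$, i.e. smooth sections of $\iota^*T^\flat M$ over $V$; * $\mathfrak X^\flat(S)^{\mathrm{ann}}(V)$ the subspace of those vanishing on the vectors tangent to $S$; * $\mathfrak X^\flat_P(S)(V)$ the subspace of those whose image by $P$ is tangent to $S$; * $\delta\iota$ the restriction of forms, $(\delta\iota\,\alpha)(y)=\alpha(y)\circ d\iota(y)$. Let $T^\flat\check M$ be a weak subbundle of $T'\check M$ such that $\delta\iota$ sends smooth sections of $\iota^*T^\flat M$ to smooth sections of $T^\flat\check M$, and such that the resulting map $\delta\iota:\mathfrak X^\flat(S,M)\to\mathfrak X^\flat(\check M)$ is surjective (so that $T^\flat_y\check M=\delta\iota(T^\flat_{\iota(y)}M)$ for all $y$). Suppose that * (RpP1) $\mathfrak X^\flat_P(S)+\mathfrak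 X^\flat(S)^{\mathrm{ann}}=\mathfrak X^\flat(S,M)$; * (RpP2) $\mathfrak X^\flat_P(S)\cap\mathfrak X^\flat(S)^{\mathrm{ann}}\subset\ker P$ at each point of $S$: if $\alpha\in\mathfrak X^\flat_P(S)(V)$ and $y\in V$ are such that $\alpha(y)$ vanishes on $d\iota(T_y\check M)$, then $P(\alpha(y))=0$. Here surjectivity and the equality (RpP1) are understood for sheaves on $\check M$, i.e. locally near each point of $\check M$ (as usual, since Banach manifolds need not have smooth bump functions). Then $S$ inherits a partial Poisson structure with anchor $\check P=d\iota^{-1}\circ P\circ(\delta\iota|_{\mathfrak X^\flat_P(S)})^{-1}$: every smooth section of $T^\flat\check M$ is locally of the form $\delta\iota(\alpha)$ with $\alpha\in\mathfrak X^\flat_P(S)$, and there is exactly one partial Poisson anchor $\check P:T^\flat\check M\to T\check M$ such that $d\iota(\check P(\delta\iota(\alpha)))=P(\alpha)$ for every open $V\subset\check M$ and every $\alpha\in\mathfrak X^\flat_P(S)(V)$. -/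

import Mathlib

open scoped Manifold ContDiff Topology

noncomputable section

namespace PartialPoisson

section Subbundle

variable {E M F : Type*} [NormedAddCommGroup E] [NormedSpace ℝ E]
  [TopologicalSpace M] [ChartedSpace E M] [NormedAddCommGroup F] [NormedSpace ℝ F]

variable (E M F) in
/-- A weak subbundle `T♭M` of the cotangent bundle `T'M` of a smooth manifold `M` modelled on `E`,
with typical fibre `F` (carrying its own Banach space structure).  The inclusion `T♭M → T'M` is,
over suitable charts of the smooth structure of `M`, the constant inclusion of `U × F` in `U × E'`
given by a continuous injection `incl : F → E'`; the transition maps between these trivialisations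
of `T♭M` are smooth maps into the Banach space of bounded endomorphisms of `F`. -/
structure WeakSubbundle where
  /-- the bounded inclusion of the typical fibre of `T♭M` in the dual of the model space -/
  incl : F →L[ℝ] (E →L[ℝ] ℝ)
  incl_injective : Function.Injective incl
  /-- the charts over which `T♭M → T'M` is the inclusion of `U × F` in `U × E'` -/
  charts : Set (OpenPartialHomeomorph M E)
  charts_subset : charts ⊆ IsManifold.maximalAtlas 𝓘(ℝ, E) ∞ M
  exists_chart : ∀ x : M, ∃ e ∈ charts, x ∈ e.source
  transition : ∀ e ∈ charts, ∀ e' ∈ charts, ∃ θ : E → F →L[ℝ] F,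
    ContDiffOn ℝ ∞ θ (e.symm.trans e').source ∧
    ∀ y ∈ (e.symm.trans e').source, ∀ v : F,
      incl (θ y v) = (incl v).comp (fderiv ℝ (e' ∘ e.symm) y)

namespace WeakSubbundle

/-- The covector at `x` with coordinate `v : F` in the chart `e`. -/
def covector (B : WeakSubbundle E M F) (e : OpenPartialHomeomorph M E) (x : M) (v : F) :
    TangentSpace 𝓘(ℝ, E) x →L[ℝ] ℝ :=
  (B.incl v).comp (mvfderiv 𝓘(ℝ, E) (e : M → E) x)

/-- The fibre `T♭ₓM ⊆ T'ₓM`: covectors having a coordinate in `F` in the charts at `x`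
(in one of them or, equivalently, in all of them). -/
def fiber (B : WeakSubbundle E M F) (x : M) :
    Submodule ℝ (TangentSpace 𝓘(ℝ, E) x →L[ℝ] ℝ) where
  carrier := {ξ | ∀ e ∈ B.charts, x ∈ e.source → ∃ v : F, ξ = B.covector e x v}
  add_mem' := by
    intro ξ η hξ hη e he hx
    obtain ⟨v, rfl⟩ := hξ e he hx
    obtain ⟨w, rfl⟩ := hη e he hx
    exact ⟨v + w, by simp [covector, ContinuousLinearMap.add_comp]⟩
  zero_mem' := fun e _ _ => ⟨0, by simp [covector]⟩
  smul_mem' := by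
    intro c ξ hξ e he hx
    obtain ⟨v, rfl⟩ := hξ e he hx
    exact ⟨c • v, by simp [covector, ContinuousLinearMap.smul_comp]⟩

/-- `α` is, over the open set `U ⊆ N`, a smooth `1`-form along the map `φ : N → M` with values in
`T♭M`, that is, a smooth section of `φ* T♭M`.  For `φ = id` these are the smooth sections of
`T♭M` over `U`. -/
def IsSectionAlong {E' N : Type*} [NormedAddCommGroup E'] [NormedSpace ℝ E']
    [TopologicalSpace N] [ChartedSpace E' N] (B : WeakSubbundle E M F) (φ : N → M) (U : Set N)
    (α : ∀ y : N, TangentSpace 𝓘(ℝ, E) (φ y) →L[ℝ] ℝ) : Prop :=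
  ∀ e ∈ B.charts, ∃ s : N → F,
    ContMDiffOn 𝓘(ℝ, E') 𝓘(ℝ, F) ∞ s (U ∩ φ ⁻¹' e.source) ∧
    ∀ y ∈ U ∩ φ ⁻¹' e.source, α y = B.covector e (φ y) (s y)

/-- Smooth sections of `T♭M` over `U`. -/
def IsSection (B : WeakSubbundle E M F) (U : Set M)
    (α : ∀ x : M, TangentSpace 𝓘(ℝ, E) x →L[ℝ] ℝ) : Prop :=
  B.IsSectionAlong (E' := E) (fun x : M => x) U α

/-- The algebra `𝔄(U)`: smooth functions `f` on the open set `U` such that `df` is a smooth section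
of `T♭M` and such that all higher derivatives `dᵏf(·, u₂, …, u_k)`, computed in the charts
trivialising `T♭M ⊆ T'M`, belong to `T♭M`.  (The derivatives being symmetric, the free slot is
taken to be the last one.) -/
def InAlgebra (B : WeakSubbundle E M F) (U : Set M) (f : M → ℝ) : Prop :=
  ContMDiffOn 𝓘(ℝ, E) 𝓘(ℝ, ℝ) ∞ f U ∧
  B.IsSection U (fun x => mvfderiv 𝓘(ℝ, E) f x) ∧
  ∀ e ∈ B.charts, ∀ x ∈ U ∩ e.source, ∀ (k : ℕ) (u : Fin k → E), ∃ v : F, ∀ w : E,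
    iteratedFDeriv ℝ (k + 1) (f ∘ e.symm) (e x) (Fin.snoc u w) = B.incl v w

/-- A family of linear maps `Pₓ : T♭ₓM → TₓM`. -/
abbrev FiberMap (B : WeakSubbundle E M F) : Type _ :=
  ∀ x : M, B.fiber x →ₗ[ℝ] TangentSpace 𝓘(ℝ, E) x

/-- `P : T♭M → TM` is a (smooth) morphism of Banach bundles. -/
def IsMorphism (B : WeakSubbundle E M F) (P : B.FiberMap) : Prop :=
  ∀ e ∈ B.charts, ∃ Q : E → F →L[ℝ] E, ContDiffOn ℝ ∞ Q e.target ∧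
    ∀ x ∈ e.source, ∀ (v : F) (h : B.covector e x v ∈ B.fiber x),
      mvfderiv 𝓘(ℝ, E) (e : M → E) x (P x ⟨B.covector e x v, h⟩) = Q (e x) v

/-- `P` is antisymmetric: `<ξ, P η> = - <η, P ξ>`. -/
def IsAntisymm (B : WeakSubbundle E M F) (P : B.FiberMap) : Prop :=
  ∀ (x : M) (ξ η : B.fiber x), ξ.1 (P x η) = - η.1 (P x ξ)

open Classical in
/-- The bracket `{f, g}_P = - <df, P (dg)>` (only meaningful where `dg` belongs to `T♭M`). -/
def bracket (B : WeakSubbundle E M F) (P : B.FiberMap) (f g : M → ℝ) : M → ℝ := fun x =>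
  if h : mvfderiv 𝓘(ℝ, E) g x ∈ B.fiber x then
    - (mvfderiv 𝓘(ℝ, E) f x (P x ⟨mvfderiv 𝓘(ℝ, E) g x, h⟩))
  else 0

/-- `P` is a partial Poisson anchor, i.e. `(T♭M, M, P, {·,·}_P)` is a partial Poisson structure:
`P` is an antisymmetric bundle morphism, and `{·,·}_P` is, over each open set `U`, an internal
operation of `𝔄(U)` which satisfies the Jacobi identity. -/
structure IsPoissonAnchor (B : WeakSubbundle E M F) (P : B.FiberMap) : Prop where
  isMorphism : B.IsMorphism P
  isAntisymm : B.IsAntisymm P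
  bracket_mem : ∀ U : Set M, IsOpen U → ∀ f g : M → ℝ,
    B.InAlgebra U f → B.InAlgebra U g → B.InAlgebra U (B.bracket P f g)
  jacobi : ∀ U : Set M, IsOpen U → ∀ f g h : M → ℝ,
    B.InAlgebra U f → B.InAlgebra U g → B.InAlgebra U h → ∀ x ∈ U,
      B.bracket P f (B.bracket P g h) x + B.bracket P g (B.bracket P h f) x
        + B.bracket P h (B.bracket P f g) x = 0

end WeakSubbundle

end Subbundle

section Restriction

variable {E M F E' N F' : Type*}
  [NormedAddCommGroup E] [NormedSpace ℝ E] [TopologicalSpace M] [ChartedSpace E M]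
  [NormedAddCommGroup F] [NormedSpace ℝ F]
  [NormedAddCommGroup E'] [NormedSpace ℝ E'] [TopologicalSpace N] [ChartedSpace E' N]
  [NormedAddCommGroup F'] [NormedSpace ℝ F']

/-- The restriction to `N` of forms along `φ : N → M`: `(δφ α)(y) = α(φ(y)) ∘ dφ(y)`. -/
def pull (φ : N → M) (α : ∀ y : N, TangentSpace 𝓘(ℝ, E) (φ y) →L[ℝ] ℝ) (y : N) :
    TangentSpace 𝓘(ℝ, E') y →L[ℝ] ℝ :=
  (α y).comp (mfderiv 𝓘(ℝ, E') 𝓘(ℝ, E) φ y)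

/-- `α` belongs, over the open set `U` of `N`, to `𝔛♭_P(S)`: it is a form along `φ` with values
in `T♭M` whose image by `P` is tangent to `S = φ(N)`. -/
def IsTangentSection (B : WeakSubbundle E M F) (P : B.FiberMap) (φ : N → M) (U : Set N)
    (α : ∀ y : N, TangentSpace 𝓘(ℝ, E) (φ y) →L[ℝ] ℝ) : Prop :=
  B.IsSectionAlong (E' := E') φ U α ∧
  ∀ y ∈ U, ∀ h : α y ∈ B.fiber (φ y), ∃ u : TangentSpace 𝓘(ℝ, E') y,
    mfderiv 𝓘(ℝ, E') 𝓘(ℝ, E) φ y u = P (φ y) ⟨α y, h⟩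

/-- `α` belongs, over the open set `U` of `N`, to `𝔛♭(S)ᵃⁿⁿ`: it is a form along `φ` with values
in `T♭M` which vanishes on the vectors tangent to `S = φ(N)`. -/
def IsAnnSection (B : WeakSubbundle E M F) (φ : N → M) (U : Set N)
    (α : ∀ y : N, TangentSpace 𝓘(ℝ, E) (φ y) →L[ℝ] ℝ) : Prop :=
  B.IsSectionAlong (E' := E') φ U α ∧
  ∀ y ∈ U, ∀ u : TangentSpace 𝓘(ℝ, E') y, α y (mfderiv 𝓘(ℝ, E') 𝓘(ℝ, E) φ y u) = 0

/-- `T♭N` is the weak subbundle of `T'N` into which `δφ` sends `𝔛♭(S, M)`: the restriction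
`δφ : 𝔛♭(S, M) → 𝔛♭(N)` is well defined and surjective (as a morphism of sheaves on `N`). -/
def IsRestriction (B : WeakSubbundle E M F) (B' : WeakSubbundle E' N F') (φ : N → M) : Prop :=
  (∀ U : Set N, IsOpen U → ∀ α : (∀ y : N, TangentSpace 𝓘(ℝ, E) (φ y) →L[ℝ] ℝ),
    B.IsSectionAlong (E' := E') φ U α → B'.IsSection U (pull φ α)) ∧
  ∀ U : Set N, IsOpen U → ∀ β : (∀ y : N, TangentSpace 𝓘(ℝ, E') y →L[ℝ] ℝ),
    B'.IsSection U β → ∀ y ∈ U, ∃ V ⊆ U, IsOpen V ∧ y ∈ V ∧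
      ∃ α : (∀ z : N, TangentSpace 𝓘(ℝ, E) (φ z) →L[ℝ] ℝ),
        B.IsSectionAlong (E' := E') φ V α ∧ ∀ z ∈ V, pull φ α z = β z

/-- `𝔛♭_P(S) + 𝔛♭(S)ᵃⁿⁿ = 𝔛♭(S, M)`, an equality of sheaves on `N` (the inclusion from left to
right always holds). -/
def RpP1 (B : WeakSubbundle E M F) (P : B.FiberMap) (φ : N → M) : Prop :=
  ∀ U : Set N, IsOpen U → ∀ α : (∀ y : N, TangentSpace 𝓘(ℝ, E) (φ y) →L[ℝ] ℝ),
    B.IsSectionAlong (E' := E') φ U α → ∀ y ∈ U, ∃ V ⊆ U, IsOpen V ∧ y ∈ V ∧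
      ∃ α₁ α₂ : (∀ z : N, TangentSpace 𝓘(ℝ, E) (φ z) →L[ℝ] ℝ),
        IsTangentSection (E' := E') B P φ V α₁ ∧ IsAnnSection (E' := E') B φ V α₂ ∧
        ∀ z ∈ V, α z = α₁ z + α₂ z

/-- `𝔛♭_P(S) ∩ 𝔛♭(S)ᵃⁿⁿ ⊆ ker P`, read at each point of `S`: a value of a form in `𝔛♭_P(S)`
which annihilates the tangent space of `S` belongs to the kernel of `P`. -/
def RpP2 (B : WeakSubbundle E M F) (P : B.FiberMap) (φ : N → M) : Prop :=
  ∀ U : Set N, IsOpen U → ∀ α : (∀ y : N, TangentSpace 𝓘(ℝ, E) (φ y) →L[ℝ] ℝ),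
    IsTangentSection (E' := E') B P φ U α → ∀ y ∈ U,
      (∀ u : TangentSpace 𝓘(ℝ, E') y, α y (mfderiv 𝓘(ℝ, E') 𝓘(ℝ, E) φ y u) = 0) →
      ∀ h : α y ∈ B.fiber (φ y), P (φ y) ⟨α y, h⟩ = 0

/-- `P' = dφ⁻¹ ∘ P ∘ (δφ restricted to 𝔛♭_P(S))⁻¹`: every section of `T♭N` is locally `δφ α` for
some `α` in `𝔛♭_P(S)`, and `dφ (P' (δφ α)) = P α` for each such `α`. -/
def IsRestrictedAnchor (B : WeakSubbundle E M F) (P : B.FiberMap)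
    (B' : WeakSubbundle E' N F') (P' : B'.FiberMap) (φ : N → M) : Prop :=
  (∀ U : Set N, IsOpen U → ∀ β : (∀ y : N, TangentSpace 𝓘(ℝ, E') y →L[ℝ] ℝ),
    B'.IsSection U β → ∀ y ∈ U, ∃ V ⊆ U, IsOpen V ∧ y ∈ V ∧
      ∃ α : (∀ z : N, TangentSpace 𝓘(ℝ, E) (φ z) →L[ℝ] ℝ),
        IsTangentSection (E' := E') B P φ V α ∧ ∀ z ∈ V, pull φ α z = β z) ∧
  ∀ U : Set N, IsOpen U → ∀ α : (∀ y : N, TangentSpace 𝓘(ℝ, E) (φ y) →L[ℝ] ℝ),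
    IsTangentSection (E' := E') B P φ U α → ∀ y ∈ U,
      ∀ (h : α y ∈ B.fiber (φ y)) (h' : pull φ α y ∈ B'.fiber y),
        mfderiv 𝓘(ℝ, E') 𝓘(ℝ, E) φ y (P' y ⟨pull φ α y, h'⟩) = P (φ y) ⟨α y, h⟩

end Restriction

end PartialPoisson

end

noncomputable section

namespace PartialPoisson

/-! ### Pointwise smooth families of operators are smooth in operator norm -/

section StrongSmoothness

open Set Filter Metric

variable {X F G : Type*} [NormedAddCommGroup X] [NormedSpace ℝ X]
  [NormedAddCommGroup F] [NormedSpace ℝ F] [NormedAddCommGroup G] [NormedSpace ℝ G]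

/-! Construction. A covector `ξ` of `T♭N` at `y` extends to a section with constant coordinate. By
surjectivity of `δφ` and (RpP1) this section lifts near `y` to some `α` in `𝔛♭_P(S)`, since `δφ`
does not see the annihilating summand. Then `P (α y) = dφ u`, and `P' ξ` has to be `u`. Two such
lifts differ by a form of `𝔛♭_P(S)` which annihilates the tangent vectors at `y`, hence has value in
`ker P` by (RpP2). As `dφ` is injective, `P'` is well defined, linear and unique. Antisymmetry is
inherited because `⟨ξ, P' η⟩ = ⟨α, P β⟩` for lifts `α`, `β`.

Smoothness. An immersion has local smooth left inverses, so `P'` sends smooth sections to smooth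
vector fields. The lifts come with no bounded dependence on the section, so the boundedness of `P'`
on fibres and its smoothness in operator norm must be recovered afterwards. The first is
`continuous_of_continuousOn_apply`: a smooth section running through small vectors with large images
would have a discontinuous image. The second is `contDiffOn_clm_of_forall_apply`, by
Banach–Steinhaus and the mean value inequality.

Bracket. In a chart where `P` is `Q`, testing the axioms on chart-linear functions yields a smooth
`C` with `⟨C u v, w⟩ = ⟨u, DQ(w) v⟩` and a pointwise Jacobi identity for `Q`
(`IsPoissonAnchor.exists_isLocalPoisson`). If `df`, `dg` have tangent lifts `a`, `b` with fields
`X`, `Y`, then `d{f,g}` is the restriction of `Db X - Da Y - C a b`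
(`IsLocalPoisson.fderiv_bracket`). This is a smooth form along `φ`, so its restriction is a section
of `T♭N` and `{f,g}` is in `𝔄`. Whether this form is tangent is never needed: Jacobi pairs it only
with `Q` of a tangent lift. There the terms in derivatives of lifts cancel by symmetry of second
derivatives, and the others by the identity for `Q` (`IsLocalPoisson.jacobi_bracketLift`). -/

theorem norm_clm_sub_le {T : X → F →L[ℝ] G} {S : X → F →L[ℝ] X →L[ℝ] G} {s : Set X}
    (hs : Convex ℝ s) (hT : ∀ v, ∀ x ∈ s, DifferentiableAt ℝ (fun z => T z v) x)
    (hS : ∀ v, ∀ x ∈ s, S x v = fderiv ℝ (fun z => T z v) x) {L : F →L[ℝ] X →L[ℝ] G} {C : ℝ}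
    (hC0 : 0 ≤ C) (hC : ∀ x ∈ s, ‖S x - L‖ ≤ C) {x y : X} (hx : x ∈ s) (hy : y ∈ s) :
    ‖T y - T x - L.flip (y - x)‖ ≤ C * ‖y - x‖ := by
  refine ContinuousLinearMap.opNorm_le_bound _ (by positivity) fun v => ?_
  have := hs.norm_image_sub_le_of_norm_fderiv_le' (f := fun z => T z v) (φ := L v)
    (C := C * ‖v‖) (𝕜 := ℝ) (fun z hz => hT v z hz) (fun z hz => by
      rw [← hS v z hz, ← sub_apply]
      exact (S z - L).le_of_opNorm_le (hC z hz) v) hx hy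
  simpa [mul_right_comm] using this

/-- Norm continuity of `S` makes the first-order remainders of all `T · v` small uniformly for `v`
in the unit ball, by the mean value inequality on a ball. -/
theorem hasFDerivAt_clm_of_forall_apply {U : Set X} (hU : IsOpen U) {T : X → F →L[ℝ] G}
    {S : X → F →L[ℝ] X →L[ℝ] G} (h : ∀ v, DifferentiableOn ℝ (fun x => T x v) U)
    (hS : ∀ x ∈ U, ∀ v, S x v = fderiv ℝ (fun z => T z v) x) (hc : ContinuousOn S U)
    {x : X} (hx : x ∈ U) : HasFDerivAt T (S x).flip x := by
  rw [hasFDerivAt_iff_isLittleO, Asymptotics.isLittleO_iff]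
  intro ε hε
  have h1 : ∀ᶠ z in 𝓝 x, z ∈ U ∧ ‖S z - S x‖ ≤ ε := by
    have hlim := (tendsto_iff_norm_sub_tendsto_zero (E := F →L[ℝ] X →L[ℝ] G)).1
      (hc.continuousAt (hU.mem_nhds hx)).tendsto
    filter_upwards [hU.mem_nhds hx, hlim.eventually (ge_mem_nhds hε)] with z hzU hz
    exact ⟨hzU, hz⟩
  obtain ⟨r, hr, hb⟩ := Metric.eventually_nhds_iff_ball.1 h1
  filter_upwards [ball_mem_nhds x hr] with z hz
  exact norm_clm_sub_le (convex_ball x r)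
    (fun v y hy => (h v).differentiableAt (hU.mem_nhds (hb y hy).1))
    (fun v y hy => hS y (hb y hy).1 v) hε.le (fun y hy => (hb y hy).2) (mem_ball_self hr) hz

variable [CompleteSpace F]

/-- The derivatives of a pointwise differentiable family of operators form an operator. -/
theorem exists_clm_fderiv_apply {T : X → F →L[ℝ] G} {x : X}
    (h : ∀ v, DifferentiableAt ℝ (fun z => T z v) x) :
    ∃ S : F →L[ℝ] X →L[ℝ] G, ∀ v, S v = fderiv ℝ (fun z => T z v) x := by
  have hlim : ∀ u : X, ∀ v : F, Tendsto (fun n : ℕ => ((n : ℝ) • (T (x + (n : ℝ)⁻¹ • u) - T x)) v)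
      atTop (𝓝 (fderiv ℝ (fun z => T z v) x u)) := by
    intro u v
    have := (h v).hasFDerivAt.lim_real u
    have := this.comp (tendsto_natCast_atTop_atTop (R := ℝ))
    simpa [Function.comp_def] using this
  -- For fixed `u`, a pointwise limit of difference quotients is bounded in `v`. A second use of
  -- Banach–Steinhaus, over `u` in the unit ball, makes the bound uniform in `u`.
  let A : X → F →L[ℝ] G := fun u => continuousLinearMapOfTendsto
    (fun n : ℕ => ((n : ℝ) • (T (x + (n : ℝ)⁻¹ • u) - T x)))
    (f := fun v => fderiv ℝ (fun z => T z v) x u) (tendsto_pi_nhds.2 fun v => hlim u v)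
  have hA : ∀ u v, A u v = fderiv ℝ (fun z => T z v) x u := fun u v => rfl
  obtain ⟨C, hC⟩ : ∃ C, ∀ u : closedBall (0 : X) 1, ‖A u‖ ≤ C := by
    apply banach_steinhaus
    intro v
    refine ⟨‖fderiv ℝ (fun z => T z v) x‖, fun u => ?_⟩
    rw [hA]
    refine (ContinuousLinearMap.le_opNorm _ _).trans ?_
    have : ‖(u : X)‖ ≤ 1 := mem_closedBall_zero_iff.1 u.2
    exact mul_le_of_le_one_right (norm_nonneg _) this
  have hC0 : 0 ≤ C := (norm_nonneg _).trans (hC ⟨0, by simp⟩)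
  let S : F →ₗ[ℝ] X →L[ℝ] G :=
    { toFun := fun v => fderiv ℝ (fun z => T z v) x
      map_add' := fun v w => ContinuousLinearMap.ext fun u => (A u).map_add v w
      map_smul' := fun c w => ContinuousLinearMap.ext fun u => (A u).map_smul c w }
  refine ⟨S.mkContinuous C fun v => ?_, fun v => rfl⟩
  refine ContinuousLinearMap.opNorm_le_of_unit_norm (by positivity) fun u hu => ?_
  change ‖A u v‖ ≤ _
  exact (A u).le_of_opNorm_le (hC ⟨u, by simp [hu]⟩) v

/-- The operators of pointwise derivatives are locally bounded in norm, so `T` is Lipschitz at each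
point. Were they unbounded along `z n → x`, their pointwise convergence, from the `C¹` hypothesis,
would contradict Banach–Steinhaus. -/
theorem continuousOn_clm_of_forall_apply {U : Set X} (hU : IsOpen U) {T : X → F →L[ℝ] G}
    (h : ∀ v, ContDiffOn ℝ 1 (fun x => T x v) U) : ContinuousOn T U := by
  have hd : ∀ v, ∀ x ∈ U, DifferentiableAt ℝ (fun z => T z v) x := fun v x hx =>
    ((h v).contDiffAt (hU.mem_nhds hx)).differentiableAt one_ne_zero
  have hex : ∀ x, ∃ S : F →L[ℝ] X →L[ℝ] G, x ∈ U → ∀ v, S v = fderiv ℝ (fun z => T z v) x := by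
    intro x
    by_cases hx : x ∈ U
    · obtain ⟨S, hS⟩ := exists_clm_fderiv_apply (fun v => hd v x hx)
      exact ⟨S, fun _ => hS⟩
    · exact ⟨0, fun h => absurd h hx⟩
  choose S hS using hex
  intro x hx
  have hbd : ∃ C : ℕ, ∃ r > 0, ball x r ⊆ U ∧ ∀ z ∈ ball x r, ‖S z‖ ≤ C := by
    by_contra! hcon
    obtain ⟨r, hr, hrU⟩ := Metric.isOpen_iff.1 hU x hx
    have : ∀ n : ℕ, ∃ z ∈ ball x (min r (1 / ((n : ℝ) + 1))), (n : ℝ) < ‖S z‖ := fun n =>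
      hcon n _ (by positivity) ((ball_subset_ball (min_le_left _ _)).trans hrU)
    choose z hz hzn using this
    have hzU : ∀ n, z n ∈ U := fun n => hrU (ball_subset_ball (min_le_left _ _) (hz n))
    have hlim : Tendsto z atTop (𝓝 x) := by
      rw [tendsto_iff_dist_tendsto_zero]
      refine squeeze_zero (fun _ => dist_nonneg) (fun n => ?_)
        (tendsto_one_div_add_atTop_nhds_zero_nat (𝕜 := ℝ))
      exact ((mem_ball.1 (hz n)).trans_le (min_le_right _ _)).le
    obtain ⟨C, hC⟩ : ∃ C, ∀ n, ‖S (z n)‖ ≤ C := by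
      apply banach_steinhaus
      intro v
      have hcont : ContinuousOn (fderiv ℝ (fun z => T z v)) U :=
        (h v).continuousOn_fderiv_of_isOpen hU le_rfl
      have h1 : Tendsto (fun n => S (z n) v) atTop (𝓝 (S x v)) := by
        rw [hS x hx v]
        refine ((hcont.continuousAt (hU.mem_nhds hx)).tendsto.comp hlim).congr fun n => ?_
        simp [hS (z n) (hzU n) v]
      obtain ⟨C, hC⟩ := h1.norm.bddAbove_range
      exact ⟨C, fun n => hC ⟨n, rfl⟩⟩
    obtain ⟨n, hn⟩ := exists_nat_gt C
    exact absurd (hC n) (not_le.2 (hn.trans (hzn n)))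
  obtain ⟨C, r, hr, hrU, hC⟩ := hbd
  have hLip : ∀ z ∈ ball x r, ‖T z - T x‖ ≤ C * ‖z - x‖ := by
    intro z hz
    have := norm_clm_sub_le (L := 0) (convex_ball x r) (fun v y hy => hd v y (hrU hy))
      (fun v y hy => hS y (hrU hy) v) C.cast_nonneg (by simpa using hC) (mem_ball_self hr) hz
    simpa using this
  apply ContinuousAt.continuousWithinAt
  rw [ContinuousAt, tendsto_iff_norm_sub_tendsto_zero]
  refine squeeze_zero' (Eventually.of_forall fun _ => norm_nonneg _)
    (eventually_of_mem (ball_mem_nhds x hr) hLip) ?_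
  have : ContinuousAt (fun z => (C : ℝ) * ‖z - x‖) x := by fun_prop
  simpa [ContinuousAt] using this

/-- The derivative of `T` is, up to `flip`, the family `S`, again pointwise smooth but with values
in `X →L[ℝ] G`. The induction therefore quantifies over `G`, in a universe that absorbs the one of
`X`. -/
theorem contDiffOn_clm_of_forall_apply_aux.{u, v, w} {X : Type u} {F : Type v}
    [NormedAddCommGroup X] [NormedSpace ℝ X]
    [NormedAddCommGroup F] [NormedSpace ℝ F] [CompleteSpace F] {U : Set X} (hU : IsOpen U)
    (n : ℕ) : ∀ {G : Type max u w} [NormedAddCommGroup G] [NormedSpace ℝ G]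
    {T : X → F →L[ℝ] G}, (∀ v, ContDiffOn ℝ ∞ (fun x => T x v) U) → ContDiffOn ℝ n T U := by
  induction n with
  | zero =>
    intro G _ _ T h
    rw [Nat.cast_zero, contDiffOn_zero]
    exact continuousOn_clm_of_forall_apply hU fun v => (h v).of_le (by exact_mod_cast le_top)
  | succ n ih =>
    intro G _ _ T h
    have hd : ∀ v, ∀ x ∈ U, DifferentiableAt ℝ (fun z => T z v) x := fun v x hx =>
      ((h v).contDiffAt (hU.mem_nhds hx)).differentiableAt (by simp)
    have hex : ∀ x, ∃ S : F →L[ℝ] X →L[ℝ] G,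
        x ∈ U → ∀ v, S v = fderiv ℝ (fun z => T z v) x := by
      intro x
      by_cases hx : x ∈ U
      · obtain ⟨S, hS⟩ := exists_clm_fderiv_apply (fun v => hd v x hx)
        exact ⟨S, fun _ => hS⟩
      · exact ⟨0, fun h => absurd h hx⟩
    choose S hS using hex
    have hSs : ∀ v, ContDiffOn ℝ ∞ (fun x => S x v) U := fun v =>
      ((contDiffOn_infty_iff_fderiv_of_isOpen hU).1 (h v)).2.congr fun x hx => hS x hx v
    have hSc : ContinuousOn S U :=
      continuousOn_clm_of_forall_apply hU fun v => (hSs v).of_le (by exact_mod_cast le_top)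
    have hder : ∀ x ∈ U, HasFDerivAt T (S x).flip x := fun x hx =>
      hasFDerivAt_clm_of_forall_apply hU (fun v z hz => (hd v z hz).differentiableWithinAt) hS
        hSc hx
    rw [Nat.cast_succ, contDiffOn_succ_iff_fderiv_of_isOpen hU]
    refine ⟨fun x hx => (hder x hx).differentiableAt.differentiableWithinAt, by simp, ?_⟩
    have hflip : ContDiff ℝ n (ContinuousLinearMap.flipₗᵢ ℝ F X G) :=
      LinearIsometryEquiv.contDiff (E := F →L[ℝ] X →L[ℝ] G) (F := X →L[ℝ] F →L[ℝ] G) _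
    have h2 := hflip.comp_contDiffOn (ih hSs)
    exact h2.congr fun x hx => (hder x hx).fderiv

/-- A family of bounded operators on a Banach space which is smooth pointwise is smooth for the
operator norm. -/
theorem contDiffOn_clm_of_forall_apply.{u, v, w} {X : Type u} {F : Type v} {G : Type w}
    [NormedAddCommGroup X] [NormedSpace ℝ X] [NormedAddCommGroup F] [NormedSpace ℝ F]
    [CompleteSpace F] [NormedAddCommGroup G] [NormedSpace ℝ G] {U : Set X} (hU : IsOpen U) {T : X → F →L[ℝ] G}
    (h : ∀ v, ContDiffOn ℝ ∞ (fun x => T x v) U) : ContDiffOn ℝ ∞ T U := by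
  rw [contDiffOn_infty]
  intro n
  let i : ULift.{max u w} G ≃L[ℝ] G := ContinuousLinearEquiv.ulift
  have h1 : ContDiffOn ℝ n (fun x => (i.symm : G →L[ℝ] ULift G).comp (T x)) U :=
    contDiffOn_clm_of_forall_apply_aux hU n fun v =>
      i.symm.contDiff.comp_contDiffOn (h v)
  have h2 : ContDiffOn ℝ n
      (fun x => (i : ULift G →L[ℝ] G).comp ((i.symm : G →L[ℝ] ULift G).comp (T x))) U :=
    contDiffOn_const.clm_comp h1
  exact h2.congr fun x _ => by ext v; simp

end StrongSmoothness

/-! ### Automatic continuity of linear maps preserving regularity of sections -/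

section AutomaticContinuity

open Set Filter Metric

theorem abs_half_pow_sub_ge {m n : ℕ} (h : m ≠ n) :
    (1 / 2 : ℝ) ^ n / 2 ≤ |(1 / 2 : ℝ) ^ m - (1 / 2) ^ n| := by
  rcases lt_or_gt_of_ne h with h | h
  · have : (1 / 2 : ℝ) ^ n ≤ (1 / 2) ^ (m + 1) :=
      pow_le_pow_of_le_one (by norm_num) (by norm_num) h
    rw [pow_succ] at this
    have h0 : (0 : ℝ) < (1 / 2) ^ n := by positivity
    rw [abs_of_nonneg (by linarith)]
    linarith
  · have : (1 / 2 : ℝ) ^ m ≤ (1 / 2) ^ (n + 1) :=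
      pow_le_pow_of_le_one (by norm_num) (by norm_num) h
    rw [pow_succ] at this
    have h0 : (0 : ℝ) < (1 / 2) ^ m := by positivity
    rw [abs_sub_comm, abs_of_nonneg (by linarith)]
    linarith

/-- Every sequence which decreases fast enough is interpolated by a smooth curve. -/
theorem exists_contDiff_curve_interpolating {F : Type*} [NormedAddCommGroup F] [NormedSpace ℝ F]
    [CompleteSpace F] : ∃ δ : ℕ → ℝ, (∀ n, 0 < δ n) ∧ ∀ v : ℕ → F, (∀ n, ‖v n‖ ≤ δ n) →
      ∃ γ : ℝ → F, ContDiff ℝ ∞ γ ∧ γ 0 = 0 ∧ ∀ n : ℕ, γ ((1 / 2) ^ n) = v n := by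
  let ψ : ∀ n : ℕ, ContDiffBump ((1 / 2 : ℝ) ^ n) := fun n =>
    ⟨(1 / 2) ^ n / 4, (1 / 2) ^ n / 2, by positivity, by
      have : (0 : ℝ) < (1 / 2) ^ n := by positivity
      linarith⟩
  have hψ : ∀ n, ContDiff ℝ ∞ (ψ n : ℝ → ℝ) := fun n => (ψ n).contDiff
  have hb : ∀ n k : ℕ, ∃ C : ℝ, ∀ t, ‖iteratedFDeriv ℝ k (ψ n : ℝ → ℝ) t‖ ≤ C := fun n k =>
    ((ψ n).hasCompactSupport.iteratedFDeriv k).exists_bound_of_continuous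
      ((hψ n).continuous_iteratedFDeriv (by exact_mod_cast le_top))
  choose C hC using hb
  have hC0 : ∀ n k, 0 ≤ C n k := fun n k => (norm_nonneg _).trans (hC n k 0)
  -- `D n` bounds the derivatives of `ψ n` of order at most `n`. With `δ n = 2⁻ⁿ / D n`, the `k`-th
  -- derivative of the `n`-th term is at most `2⁻ⁿ` for `n ≥ k`, which suffices for a smooth sum.
  let D : ℕ → ℝ := fun n => 1 + ∑ k ∈ Finset.range (n + 1), C n k
  have hD : ∀ n, 0 < D n := fun n => by
    have : 0 ≤ ∑ k ∈ Finset.range (n + 1), C n k := Finset.sum_nonneg fun k _ => hC0 n k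
    simp only [D]; linarith
  have hCD : ∀ n k, k ≤ n → C n k ≤ D n := fun n k hk => by
    have := Finset.single_le_sum (f := fun k => C n k) (fun k _ => hC0 n k)
      (Finset.mem_range.2 (Nat.lt_succ_of_le hk))
    simp only [D]; linarith
  refine ⟨fun n => (1 / 2) ^ n / D n, fun n => div_pos (by positivity) (hD n), fun v hv => ?_⟩
  have hψ0 : ∀ n t, (1 / 2 : ℝ) ^ n / 2 ≤ |t - (1 / 2) ^ n| → ψ n t = 0 := fun n t h =>
    (ψ n).zero_of_le_dist (by simpa [Real.dist_eq, ψ] using h)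
  refine ⟨fun t => ∑' n, ψ n t • v n, ?_, ?_, ?_⟩
  · refine contDiff_tsum_of_eventually (v := fun _ n => (1 / 2) ^ n) (N := ⊤)
      (fun n => (hψ n).smul contDiff_const) (fun k _ => summable_geometric_two) ?_
    intro k _
    rw [Nat.cofinite_eq_atTop, eventually_atTop]
    refine ⟨k, fun n hn t => ?_⟩
    have h1 : (fun t => ψ n t • v n)
        = ((ContinuousLinearMap.id ℝ ℝ).smulRight (v n)) ∘ (ψ n : ℝ → ℝ) := by
      ext t; simp
    rw [h1, ContinuousLinearMap.iteratedFDeriv_comp_left _ (hψ n).contDiffAt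
      (by exact_mod_cast le_top)]
    refine (ContinuousLinearMap.norm_compContinuousMultilinearMap_le _ _).trans ?_
    have h2 : ‖(ContinuousLinearMap.id ℝ ℝ).smulRight (v n)‖ ≤ ‖v n‖ := by
      rw [ContinuousLinearMap.norm_smulRight_apply]
      exact mul_le_of_le_one_left (norm_nonneg _) ContinuousLinearMap.norm_id_le
    calc _ ≤ (1 / 2) ^ n / D n * D n :=
          mul_le_mul (h2.trans (hv n)) ((hC n k t).trans (hCD n k hn)) (norm_nonneg _)
            (div_pos (by positivity) (hD n)).le
      _ = _ := div_mul_cancel₀ _ (hD n).ne'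
  · have : ∀ n, ψ n 0 • v n = 0 := fun n => by
      rw [hψ0 n 0 (by rw [zero_sub, abs_neg, abs_of_nonneg (by positivity)]
                      have : (0 : ℝ) < (1 / 2) ^ n := by positivity
                      linarith), zero_smul]
    simp only [this, tsum_zero]
  · intro n
    dsimp only
    rw [tsum_eq_single n fun m hm => by rw [hψ0 m _ (abs_half_pow_sub_ge hm.symm), zero_smul],
      (ψ n).one_of_mem_closedBall (mem_closedBall_self (ψ n).rIn_pos.le), one_smul]

/-- A family of linear maps between Banach spaces which maps smooth sections to continuous ones
consists of continuous maps. -/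
theorem continuous_of_continuousOn_apply {X F G : Type*} [NormedAddCommGroup X] [NormedSpace ℝ X]
    [Nontrivial X] [NormedAddCommGroup F] [NormedSpace ℝ F] [CompleteSpace F]
    [NormedAddCommGroup G] [NormedSpace ℝ G] {U : Set X} (hU : IsOpen U) {L : X → F →ₗ[ℝ] G}
    (h : ∀ β : X → F, ContDiff ℝ ∞ β → ContinuousOn (fun y => L y (β y)) U) {x : X} (hx : x ∈ U) :
    Continuous (L x) := by
  obtain ⟨u, hu⟩ := exists_ne (0 : X)
  obtain ⟨ℓ, -, hℓ⟩ := exists_dual_vector ℝ u (norm_ne_zero_iff.2 hu)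
  obtain ⟨ℓ, hℓ⟩ : ∃ ℓ : X →L[ℝ] ℝ, ℓ u = 1 :=
    ⟨‖u‖⁻¹ • ℓ, by simp [hℓ, hu]⟩
  let y : ℕ → X := fun n => x + (1 / 2 : ℝ) ^ n • u
  have hpow : Tendsto (fun n : ℕ => (1 / 2 : ℝ) ^ n) atTop (𝓝 0) :=
    tendsto_pow_atTop_nhds_zero_of_lt_one (by norm_num) (by norm_num)
  have hy : Tendsto y atTop (𝓝 x) := by
    simpa [y] using (hpow.smul_const u).const_add x
  -- If `L (y n)` is bounded for infinitely many `n`, then `L x` is a pointwise limit of bounded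
  -- operators, hence bounded. Otherwise `L (y n)` is unbounded for all large `n`, and a smooth
  -- section through bad vectors gives a contradiction.
  by_cases hfreq : ∃ᶠ n in atTop, Continuous (L (y n))
  · obtain ⟨k, hk, hkc⟩ := extraction_of_frequently_atTop hfreq
    let A : ℕ → F →L[ℝ] G := fun n => ⟨L (y (k n)), hkc n⟩
    have hA : Tendsto (fun n v => A n v) atTop (𝓝 (fun v => L x v)) := by
      rw [tendsto_pi_nhds]
      intro v
      exact ((h (fun _ => v) contDiff_const).continuousAt (hU.mem_nhds hx)).tendsto.comp
        (hy.comp hk.tendsto_atTop)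
    exact (continuousLinearMapOfTendsto A hA).continuous
  · exfalso
    obtain ⟨δ, hδ, hγ⟩ := exists_contDiff_curve_interpolating (F := F)
    have hv : ∀ n, ∃ v : F, ‖v‖ ≤ δ n ∧ (¬ Continuous (L (y n)) → 1 < ‖L (y n) v‖) := by
      intro n
      by_cases hc : Continuous (L (y n))
      · exact ⟨0, by simpa using (hδ n).le, fun h => absurd hc h⟩
      · by_contra! hcon
        apply hc
        refine AddMonoidHomClass.continuous_of_bound (L (y n)) (1 / δ n) fun w => ?_
        by_cases hw : w = 0
        · simp [hw]
        have hw' : 0 < ‖w‖ := norm_pos_iff.2 hw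
        have := (hcon ((δ n / ‖w‖) • w) (by
          rw [norm_smul, Real.norm_of_nonneg (by have := hδ n; positivity),
            div_mul_cancel₀ _ hw'.ne'])).2
        rw [map_smul, norm_smul, Real.norm_of_nonneg (by have := hδ n; positivity)] at this
        rw [div_mul_eq_mul_div, le_div_iff₀ (hδ n), one_mul]
        rw [div_mul_eq_mul_div, div_le_iff₀ hw', one_mul] at this
        linarith
    choose v hvδ hv1 using hv
    obtain ⟨γ, hγs, hγ0, hγv⟩ := hγ v hvδ
    -- Since `ℓ u = 1`, this section takes the value `v n` at `y n` and vanishes at `x`, while `‖L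
    -- (y n) (v n)‖ > 1` for large `n`.
    have hβ : ContDiff ℝ ∞ (fun z => γ (ℓ (z - x))) :=
      hγs.comp (ℓ.contDiff.comp (contDiff_id.sub contDiff_const))
    have hlim := ((h _ hβ).continuousAt (hU.mem_nhds hx)).tendsto.comp hy
    have hlim' : Tendsto (fun n => ‖L (y n) (v n)‖) atTop (𝓝 0) := by
      have h2 : ∀ n, γ (ℓ (y n - x)) = v n := fun n => by simp [y, hℓ, ← hγv]
      simp only [sub_self, map_zero, hγ0, Function.comp_def, h2] at hlim
      simpa only [norm_zero] using hlim.norm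
    have hev : ∀ᶠ n in atTop, ¬ Continuous (L (y n)) := not_frequently.1 hfreq
    obtain ⟨n, hn, hn'⟩ := (hev.and (hlim'.eventually (gt_mem_nhds one_pos))).exists
    exact absurd (hv1 n hn) (not_lt.2 hn'.le)

end AutomaticContinuity

/-! ### Bracket calculus in charts, along a map into a Banach space -/

section LocalBracket

variable {E F E' : Type*} [NormedAddCommGroup E] [NormedSpace ℝ E]
  [NormedAddCommGroup F] [NormedSpace ℝ F] [NormedAddCommGroup E'] [NormedSpace ℝ E']

/-- A partial Poisson anchor `Q` over an open subset `O` of a Banach space, together with the map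
`C` such that `⟨C x u v, w⟩ = ⟨u, DQ x w v⟩`. -/
structure IsLocalPoisson (incl : F →L[ℝ] E →L[ℝ] ℝ) (O : Set E) (Q : E → F →L[ℝ] E)
    (C : E → F →L[ℝ] F →L[ℝ] F) : Prop where
  isOpen : IsOpen O
  contDiffOn : ContDiffOn ℝ ∞ Q O
  contDiffOn_deriv : ContDiffOn ℝ ∞ C O
  antisymm : ∀ x ∈ O, ∀ u v, incl u (Q x v) = - incl v (Q x u)
  incl_deriv : ∀ x ∈ O, ∀ u v w, incl (C x u v) w = incl u (fderiv ℝ Q x w v)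
  jacobi : ∀ x ∈ O, ∀ u v w, incl u (fderiv ℝ Q x (Q x v) w) + incl v (fderiv ℝ Q x (Q x w) u)
    + incl w (fderiv ℝ Q x (Q x u) v) = 0

/-- `a` is a lift along `φ` of the differential of `f`, whose image by `Q` is tangent to `φ`, the
corresponding vector field being `X`. -/
structure IsTangentLift (incl : F →L[ℝ] E →L[ℝ] ℝ) (Q : E → F →L[ℝ] E) (φ : E' → E) (W : Set E')
    (f : E' → ℝ) (a : E' → F) (X : E' → E') : Prop where
  contDiffOn : ContDiffOn ℝ ∞ f W
  contDiffOn_lift : ContDiffOn ℝ ∞ a W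
  contDiffOn_field : ContDiffOn ℝ ∞ X W
  fderiv_eq : ∀ p ∈ W, ∀ w, fderiv ℝ f p w = incl (a p) (fderiv ℝ φ p w)
  map_field : ∀ p ∈ W, fderiv ℝ φ p (X p) = Q (φ p) (a p)

variable {incl : F →L[ℝ] E →L[ℝ] ℝ} {O : Set E} {Q : E → F →L[ℝ] E} {C : E → F →L[ℝ] F →L[ℝ] F}
  {φ : E' → E} {W : Set E'}

/-- Differentiating `df = ⟨a, dφ⟩` gives `D²f(u, w) = ⟨Da u, dφ w⟩ + ⟨a, D²φ(u, w)⟩`, where both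
second derivatives are symmetric. This replaces the closedness of a form that is defined only along
`φ`. -/
theorem IsTangentLift.symm {f : E' → ℝ} {a : E' → F} {X : E' → E'}
    (h : IsTangentLift incl Q φ W f a X) (hW : IsOpen W) (hφ : ContDiffOn ℝ ∞ φ W)
    {p : E'} (hp : p ∈ W) (u w : E') :
    incl (fderiv ℝ a p u) (fderiv ℝ φ p w) = incl (fderiv ℝ a p w) (fderiv ℝ φ p u) := by
  have hn := hW.mem_nhds hp
  have hφp : ContDiffAt ℝ ∞ φ p := hφ.contDiffAt hn
  have hfp : ContDiffAt ℝ ∞ f p := h.contDiffOn.contDiffAt hn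
  have hap : HasFDerivAt a (fderiv ℝ a p) p :=
    ((h.contDiffOn_lift.contDiffAt hn).differentiableAt (by simp)).hasFDerivAt
  have hφ2 : HasFDerivAt (fderiv ℝ φ) (fderiv ℝ (fderiv ℝ φ) p) p :=
    ((hφp.fderiv_right (m := ∞) (by simp)).differentiableAt (by simp)).hasFDerivAt
  have hev : fderiv ℝ f =ᶠ[𝓝 p] fun q => (incl (a q)).comp (fderiv ℝ φ q) :=
    Filter.eventuallyEq_of_mem hn fun q hq => ContinuousLinearMap.ext fun w => h.fderiv_eq q hq w
  have hd := ((incl.hasFDerivAt.comp p hap).clm_comp hφ2).congr_of_eventuallyEq hev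
  have h2 : minSmoothness ℝ 2 ≤ (∞ : WithTop ℕ∞) := by
    rw [minSmoothness_of_isRCLikeNormedField]
    exact WithTop.coe_le_coe.2 (le_top : (2 : ℕ∞) ≤ ⊤)
  have hsymf := (hfp.isSymmSndFDerivAt h2).eq u w
  have hsymφ := (hφp.isSymmSndFDerivAt h2).eq u w
  rw [hd.fderiv] at hsymf
  simp [hsymφ] at hsymf
  exact hsymf

/-- The lift of the differential of the bracket of two functions. -/
def bracketLift (C : E → F →L[ℝ] F →L[ℝ] F) (φ : E' → E) (a b : E' → F) (X Y : E' → E') (p : E') :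
    F :=
  fderiv ℝ b p (X p) - fderiv ℝ a p (Y p) - C (φ p) (a p) (b p)

variable {f g k : E' → ℝ} {a b c : E' → F} {X Y Z : E' → E'}

theorem IsTangentLift.contDiffOn_bracketLift (hC : ContDiffOn ℝ ∞ C O) (hW : IsOpen W)
    (hφ : ContDiffOn ℝ ∞ φ W) (hWO : Set.MapsTo φ W O)
    (hf : IsTangentLift incl Q φ W f a X) (hg : IsTangentLift incl Q φ W g b Y) :
    ContDiffOn ℝ ∞ (bracketLift C φ a b X Y) W := by
  have ha' := ((contDiffOn_infty_iff_fderiv_of_isOpen hW).1 hf.contDiffOn_lift).2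
  have hb' := ((contDiffOn_infty_iff_fderiv_of_isOpen hW).1 hg.contDiffOn_lift).2
  exact ((hb'.clm_apply hf.contDiffOn_field).sub (ha'.clm_apply hg.contDiffOn_field)).sub
    (((hC.comp hφ hWO).clm_apply hf.contDiffOn_lift).clm_apply hg.contDiffOn_lift)

/-- Antisymmetry of `Q` and tangency `Q a = dφ X`, `Q b = dφ Y` turn the terms in `Da w`, `Db w`
into pairings with `dφ`. `IsTangentLift.symm` then moves `w` out of the derivative, and `C` does the
same for the term in `DQ`. -/
theorem IsLocalPoisson.fderiv_bracket (h : IsLocalPoisson incl O Q C) (hW : IsOpen W)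
    (hφ : ContDiffOn ℝ ∞ φ W) (hWO : Set.MapsTo φ W O)
    (hf : IsTangentLift incl Q φ W f a X) (hg : IsTangentLift incl Q φ W g b Y)
    {p : E'} (hp : p ∈ W) (w : E') :
    fderiv ℝ (fun q => - incl (a q) (Q (φ q) (b q))) p w
      = incl (bracketLift C φ a b X Y p) (fderiv ℝ φ p w) := by
  have hn := hW.mem_nhds hp
  have hap : HasFDerivAt a (fderiv ℝ a p) p :=
    ((hf.contDiffOn_lift.contDiffAt hn).differentiableAt (by simp)).hasFDerivAt
  have hbp : HasFDerivAt b (fderiv ℝ b p) p :=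
    ((hg.contDiffOn_lift.contDiffAt hn).differentiableAt (by simp)).hasFDerivAt
  have hφp : HasFDerivAt φ (fderiv ℝ φ p) p :=
    ((hφ.contDiffAt hn).differentiableAt (by simp)).hasFDerivAt
  have hQp : HasFDerivAt Q (fderiv ℝ Q (φ p)) (φ p) :=
    ((h.contDiffOn.contDiffAt (h.isOpen.mem_nhds (hWO hp))).differentiableAt (by simp)).hasFDerivAt
  have hd := ((incl.hasFDerivAt.comp p hap).clm_apply ((hQp.comp p hφp).clm_apply hbp)).neg
  have e1 := hf.symm hW hφ hp w (Y p)
  have e2 := hg.symm hW hφ hp w (X p)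
  rw [hg.map_field p hp] at e1
  rw [hf.map_field p hp] at e2
  have e3 := h.antisymm (φ p) (hWO hp) (a p) (fderiv ℝ b p w)
  have e4 := h.incl_deriv (φ p) (hWO hp) (a p) (b p) (fderiv ℝ φ p w)
  have e5 : fderiv ℝ (fun q => - incl (a q) (Q (φ q) (b q))) p w
      = -(incl (a p) (Q (φ p) (fderiv ℝ b p w) + fderiv ℝ Q (φ p) (fderiv ℝ φ p w) (b p))
        + incl (fderiv ℝ a p w) (Q (φ p) (b p))) := by
    refine (congrArg (fun L : E' →L[ℝ] ℝ => L w) hd.fderiv).trans ?_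
    simp
  rw [e5, bracketLift]
  simp only [map_add, map_sub, sub_apply, e4, ← e1, ← e2, e3]
  ring

theorem IsLocalPoisson.jacobi_bracketLift (h : IsLocalPoisson incl O Q C) (hW : IsOpen W)
    (hφ : ContDiffOn ℝ ∞ φ W) (hWO : Set.MapsTo φ W O)
    (hf : IsTangentLift incl Q φ W f a X) (hg : IsTangentLift incl Q φ W g b Y)
    (hk : IsTangentLift incl Q φ W k c Z) {p : E'} (hp : p ∈ W) :
    incl (bracketLift C φ b c Y Z p) (Q (φ p) (a p))
      + incl (bracketLift C φ c a Z X p) (Q (φ p) (b p))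
      + incl (bracketLift C φ a b X Y p) (Q (φ p) (c p)) = 0 := by
  have ea := hf.symm hW hφ hp (Y p) (Z p)
  have eb := hg.symm hW hφ hp (X p) (Z p)
  have ec := hk.symm hW hφ hp (X p) (Y p)
  rw [hf.map_field p hp, hg.map_field p hp] at ec
  rw [hf.map_field p hp, hk.map_field p hp] at eb
  rw [hg.map_field p hp, hk.map_field p hp] at ea
  -- The cyclic order `a, c, b` is the one produced by the three terms in `C`. All terms in `Da`,
  -- `Db`, `Dc` cancel in pairs by `ea`, `eb`, `ec`.
  have hj := h.jacobi (φ p) (hWO hp) (a p) (c p) (b p)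
  simp only [bracketLift, map_sub, sub_apply, h.incl_deriv (φ p) (hWO hp)]
  linarith

end LocalBracket

/-! ### Differentials in charts and local left inverses of immersions -/

section Charts

variable {E M G E' N : Type*} [NormedAddCommGroup E] [NormedSpace ℝ E]
  [TopologicalSpace M] [ChartedSpace E M] [NormedAddCommGroup G] [NormedSpace ℝ G]
  [NormedAddCommGroup E'] [NormedSpace ℝ E'] [TopologicalSpace N] [ChartedSpace E' N]

theorem mdifferentiable_of_mem_maximalAtlas {e : OpenPartialHomeomorph M E}
    (he : e ∈ IsManifold.maximalAtlas 𝓘(ℝ, E) ∞ M) : e.MDifferentiable 𝓘(ℝ, E) 𝓘(ℝ, E) :=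
  ⟨(contMDiffOn_of_mem_maximalAtlas he).mdifferentiableOn (by simp),
    (contMDiffOn_symm_of_mem_maximalAtlas he).mdifferentiableOn (by simp)⟩

theorem mvfderiv_congr {f g : M → G} {x : M} (h : f =ᶠ[𝓝 x] g) :
    mvfderiv 𝓘(ℝ, E) f x = mvfderiv 𝓘(ℝ, E) g x := by
  ext u
  exact congrArg (fun L : E →L[ℝ] G => L u) (h.mfderiv_eq (I := 𝓘(ℝ, E)) (I' := 𝓘(ℝ, G)))

theorem mvfderiv_comp_eq {φ : N → M} {f : M → G} {y : N}
    (hf : MDifferentiableAt 𝓘(ℝ, E) 𝓘(ℝ, G) f (φ y))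
    (hφ : MDifferentiableAt 𝓘(ℝ, E') 𝓘(ℝ, E) φ y) :
    mvfderiv 𝓘(ℝ, E') (f ∘ φ) y
      = (mvfderiv 𝓘(ℝ, E) f (φ y)).comp (mfderiv 𝓘(ℝ, E') 𝓘(ℝ, E) φ y) :=
  mfderiv_comp y hf hφ

/-- The differential of a chart is bijective. -/
theorem mvfderiv_chart_bijective {e : OpenPartialHomeomorph M E}
    (he : e ∈ IsManifold.maximalAtlas 𝓘(ℝ, E) ∞ M) {x : M} (hx : x ∈ e.source) :
    Function.Bijective (mvfderiv 𝓘(ℝ, E) (e : M → E) x) :=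
  (mdifferentiable_of_mem_maximalAtlas he).mfderiv_bijective hx

/-- The differential of a function in a chart. -/
theorem mvfderiv_eq_fderiv_comp {e : OpenPartialHomeomorph M E}
    (he : e ∈ IsManifold.maximalAtlas 𝓘(ℝ, E) ∞ M) {x : M} (hx : x ∈ e.source) {f : M → G}
    (hf : MDifferentiableAt 𝓘(ℝ, E) 𝓘(ℝ, G) f x) (u : TangentSpace 𝓘(ℝ, E) x) :
    mvfderiv 𝓘(ℝ, E) f x u
      = fderiv ℝ (f ∘ e.symm) (e x) (mvfderiv 𝓘(ℝ, E) (e : M → E) x u) := by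
  have hm := mdifferentiable_of_mem_maximalAtlas he
  have h1 : MDifferentiableAt 𝓘(ℝ, E) 𝓘(ℝ, G) (f ∘ e.symm) (e x) :=
    MDifferentiableAt.comp_of_eq (e x) hf (hm.mdifferentiableAt_symm (e.map_source hx))
      (e.left_inv hx)
  have h2 : f =ᶠ[𝓝 x] (f ∘ e.symm) ∘ e :=
    Filter.eventuallyEq_of_mem (e.open_source.mem_nhds hx) fun z hz => by simp [e.left_inv hz]
  rw [mvfderiv_congr h2, mvfderiv_comp_eq h1 (hm.mdifferentiableAt hx)]
  change mvfderiv 𝓘(ℝ, E) (f ∘ e.symm) (e x) _ = _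
  exact congrArg (fun L : E →L[ℝ] G => L _) (mfderiv_eq_fderiv (f := f ∘ e.symm) (x := e x))

/-- The differential of a map between manifolds in charts. -/
theorem mvfderiv_chart_mfderiv {e : OpenPartialHomeomorph M E}
    (he : e ∈ IsManifold.maximalAtlas 𝓘(ℝ, E) ∞ M) {e' : OpenPartialHomeomorph N E'}
    (he' : e' ∈ IsManifold.maximalAtlas 𝓘(ℝ, E') ∞ N) {φ : N → M} {y : N}
    (hφ : MDifferentiableAt 𝓘(ℝ, E') 𝓘(ℝ, E) φ y) (hy : y ∈ e'.source) (hy' : φ y ∈ e.source)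
    (u : TangentSpace 𝓘(ℝ, E') y) :
    mvfderiv 𝓘(ℝ, E) (e : M → E) (φ y) (mfderiv 𝓘(ℝ, E') 𝓘(ℝ, E) φ y u)
      = fderiv ℝ (e ∘ φ ∘ e'.symm) (e' y) (mvfderiv 𝓘(ℝ, E') (e' : N → E') y u) := by
  have hm := (mdifferentiable_of_mem_maximalAtlas he).mdifferentiableAt hy'
  have := mvfderiv_comp_eq hm hφ
  rw [← ContinuousLinearMap.comp_apply, ← this,
    mvfderiv_eq_fderiv_comp he' hy (hm.comp y hφ)]
  rfl

theorem contDiffOn_comp_symm {e : OpenPartialHomeomorph M E}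
    (he : e ∈ IsManifold.maximalAtlas 𝓘(ℝ, E) ∞ M) {f : M → G} {S : Set M}
    (hf : ContMDiffOn 𝓘(ℝ, E) 𝓘(ℝ, G) ∞ f S) :
    ContDiffOn ℝ ∞ (f ∘ e.symm) (e.target ∩ e.symm ⁻¹' S) :=
  (hf.comp ((contMDiffOn_symm_of_mem_maximalAtlas he).mono Set.inter_subset_left)
    fun _ hx => hx.2).contDiffOn

theorem contMDiffOn_comp_chart {e : OpenPartialHomeomorph M E}
    (he : e ∈ IsManifold.maximalAtlas 𝓘(ℝ, E) ∞ M) {g : E → G} {W : Set E}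
    (hg : ContDiffOn ℝ ∞ g W) :
    ContMDiffOn 𝓘(ℝ, E) 𝓘(ℝ, G) ∞ (g ∘ e) (e.source ∩ e ⁻¹' W) :=
  hg.contMDiffOn.comp ((contMDiffOn_of_mem_maximalAtlas he).mono Set.inter_subset_left)
    fun _ hx => hx.2

/-- An immersion has, locally, a smooth left inverse. -/
theorem exists_left_inverse_of_isImmersionAt [IsManifold 𝓘(ℝ, E) ∞ M]
    [IsManifold 𝓘(ℝ, E') ∞ N] {φ : N → M} {y : N}
    (h : Manifold.IsImmersionAt 𝓘(ℝ, E') 𝓘(ℝ, E) ∞ φ y) :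
    ∃ ρ : M → N, ∃ O : Set M, IsOpen O ∧ φ y ∈ O ∧ ContMDiffOn 𝓘(ℝ, E) 𝓘(ℝ, E') ∞ ρ O ∧
      ∃ V : Set N, IsOpen V ∧ y ∈ V ∧ ∀ z ∈ V, φ z ∈ O ∧ ρ (φ z) = z := by
  let d := h.domChart
  let c := h.codChart
  -- In the charts of the immersion `φ` is `w ↦ (w, 0)`, so the projection to the first factor
  -- inverts it on the left.
  let p : E →L[ℝ] E' := (ContinuousLinearMap.fst ℝ E' h.complement).comp
    (h.equiv.symm : E →L[ℝ] E' × h.complement)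
  have hp : ∀ z ∈ d.source, p (c (φ z)) = d z := by
    intro z hz
    have := h.writtenInCharts
      (show d z ∈ (h.domChart.extend 𝓘(ℝ, E')).target by simpa using d.map_source hz)
    simp only [Function.comp_apply] at this
    have h3 : c (φ z) = h.equiv (d z, 0) := by
      simpa [d, d.left_inv hz, c] using this
    simp [p, h3]
  refine ⟨d.symm ∘ p ∘ c, c.source ∩ c ⁻¹' (p ⁻¹' d.target),
    c.isOpen_inter_preimage (d.open_target.preimage p.continuous),
    ⟨h.mem_codChart_source, ?_⟩, ?_, d.source, d.open_source, h.mem_domChart_source, ?_⟩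
  · change p (c (φ y)) ∈ d.target
    rw [hp y h.mem_domChart_source]
    exact d.map_source h.mem_domChart_source
  · refine (contMDiffOn_symm_of_mem_maximalAtlas h.domChart_mem_maximalAtlas).comp
      (t := d.target) ?_ fun z hz => hz.2
    exact p.contMDiff.comp_contMDiffOn
      ((contMDiffOn_of_mem_maximalAtlas h.codChart_mem_maximalAtlas).mono Set.inter_subset_left)
  · intro z hz
    refine ⟨⟨h.source_subset_preimage_source hz, ?_⟩, ?_⟩
    · change p (c (φ z)) ∈ d.target
      rw [hp z hz]
      exact d.map_source hz
    · simp [hp z hz, d.left_inv hz]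

end Charts

namespace WeakSubbundle

/-! ### Smooth sections of a weak subbundle and the algebra `𝔄` -/

section Sections

variable {E M F E' N : Type*} [NormedAddCommGroup E] [NormedSpace ℝ E]
  [TopologicalSpace M] [ChartedSpace E M] [NormedAddCommGroup F] [NormedSpace ℝ F]
  [NormedAddCommGroup E'] [NormedSpace ℝ E'] [TopologicalSpace N] [ChartedSpace E' N]
  {B : WeakSubbundle E M F} {e : OpenPartialHomeomorph M E} {x : M}

theorem mem_maximalAtlas (he : e ∈ B.charts) : e ∈ IsManifold.maximalAtlas 𝓘(ℝ, E) ∞ M :=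
  B.charts_subset he

theorem covector_apply (v : F) (u : TangentSpace 𝓘(ℝ, E) x) :
    B.covector e x v u = B.incl v (mvfderiv 𝓘(ℝ, E) (e : M → E) x u) := rfl

theorem covector_smul_add (c : ℝ) (v w : F) :
    B.covector e x (c • v + w) = c • B.covector e x v + B.covector e x w := by
  ext u
  simp [covector_apply]

theorem covector_injective (he : e ∈ B.charts) (hx : x ∈ e.source) :
    Function.Injective (B.covector e x) := by
  intro v w h
  apply B.incl_injective
  ext u
  obtain ⟨u, rfl⟩ := (mvfderiv_chart_bijective (mem_maximalAtlas he) hx).2 u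
  exact congrArg (fun L : TangentSpace 𝓘(ℝ, E) x →L[ℝ] ℝ => L u) h

variable (B) in
theorem exists_transition {e' : OpenPartialHomeomorph M E} (he : e ∈ B.charts)
    (he' : e' ∈ B.charts) : ∃ θ : E → F →L[ℝ] F,
      ContDiffOn ℝ ∞ θ (e.symm.trans e').source ∧
      ∀ x ∈ e.source, x ∈ e'.source → ∀ v,
        B.covector e' x v = B.covector e x (θ (e x) v) := by
  obtain ⟨θ, hθ, h⟩ := B.transition e he e' he'
  refine ⟨θ, hθ, fun x hx hx' v => ?_⟩
  ext u
  have hy : e x ∈ (e.symm.trans e').source := by simp [hx, hx', e.left_inv hx]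
  rw [covector_apply, covector_apply, h _ hy v, mvfderiv_eq_fderiv_comp (mem_maximalAtlas he) hx
    ((mdifferentiable_of_mem_maximalAtlas (mem_maximalAtlas he')).mdifferentiableAt hx')]
  rfl

/-- A coordinate in one chart yields coordinates in every other one through the transition maps, as
the definition of `fiber` demands. -/
theorem covector_mem_fiber (he : e ∈ B.charts) (hx : x ∈ e.source) (v : F) :
    B.covector e x v ∈ B.fiber x := by
  intro e' he' hx'
  obtain ⟨θ, -, h⟩ := B.exists_transition he' he
  exact ⟨_, h x hx' hx v⟩

variable {φ : N → M} {U V : Set N} {α β : ∀ y : N, TangentSpace 𝓘(ℝ, E) (φ y) →L[ℝ] ℝ}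

theorem IsSectionAlong.mem_fiber (h : B.IsSectionAlong (E' := E') φ U α) {y : N} (hy : y ∈ U) :
    α y ∈ B.fiber (φ y) := by
  intro e he hx
  obtain ⟨s, -, hs⟩ := h e he
  exact ⟨s y, hs y ⟨hy, hx⟩⟩

theorem IsSectionAlong.mono (h : B.IsSectionAlong (E' := E') φ U α) (hVU : V ⊆ U) :
    B.IsSectionAlong (E' := E') φ V α := by
  intro e he
  obtain ⟨s, hs, hα⟩ := h e he
  have hsub := Set.inter_subset_inter_left (φ ⁻¹' e.source) hVU
  exact ⟨s, hs.mono hsub, fun y hy => hα y (hsub hy)⟩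

theorem IsSectionAlong.congr (h : B.IsSectionAlong (E' := E') φ U α) (hαβ : ∀ y ∈ U, β y = α y) :
    B.IsSectionAlong (E' := E') φ U β := by
  intro e he
  obtain ⟨s, hs, hα⟩ := h e he
  exact ⟨s, hs, fun y hy => (hαβ y hy.1).trans (hα y hy)⟩

theorem IsSectionAlong.smul_add (hα : B.IsSectionAlong (E' := E') φ U α)
    (hβ : B.IsSectionAlong (E' := E') φ U β) (c : ℝ) :
    B.IsSectionAlong (E' := E') φ U (fun y => c • α y + β y) := by
  intro e he
  obtain ⟨s, hs, hsα⟩ := hα e he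
  obtain ⟨t, ht, htβ⟩ := hβ e he
  refine ⟨fun y => c • s y + t y, ((contDiff_const_smul c).contMDiff.comp_contMDiffOn hs).add ht, fun y hy => ?_⟩
  simp only [covector_smul_add, hsα y hy, htβ y hy]

/-- A form along `φ` which is locally given by smooth coordinates is a smooth section. -/
theorem isSectionAlong_of_locally (hφ : ContMDiff 𝓘(ℝ, E') 𝓘(ℝ, E) ∞ φ)
    (h : ∀ y ∈ U, ∃ V, IsOpen V ∧ y ∈ V ∧ ∃ e ∈ B.charts, V ⊆ φ ⁻¹' e.source ∧
      ∃ s : N → F, ContMDiffOn 𝓘(ℝ, E') 𝓘(ℝ, F) ∞ s V ∧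
        ∀ z ∈ V, α z = B.covector e (φ z) (s z)) :
    B.IsSectionAlong (E' := E') φ U α := by
  intro e he
  -- Coordinates are chosen point by point with no regularity. Being unique (`covector_injective`),
  -- they agree near each point with the transported smooth ones.
  have hex : ∀ y, ∃ v : F, (∃ w, α y = B.covector e (φ y) w) → α y = B.covector e (φ y) v := by
    intro y
    by_cases hy : ∃ w, α y = B.covector e (φ y) w
    · exact ⟨hy.choose, fun _ => hy.choose_spec⟩
    · exact ⟨0, fun h => absurd h hy⟩
  choose s hs using hex
  have key : ∀ y ∈ U ∩ φ ⁻¹' e.source, α y = B.covector e (φ y) (s y) ∧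
      ContMDiffAt 𝓘(ℝ, E') 𝓘(ℝ, F) ∞ s y := by
    rintro y ⟨hyU, hye⟩
    obtain ⟨V, hV, hyV, e₀, he₀, hVe₀, t, ht, hα⟩ := h y hyU
    obtain ⟨θ, hθ, htr⟩ := B.exists_transition he he₀
    have hval : ∀ z ∈ V ∩ φ ⁻¹' e.source, α z = B.covector e (φ z) (θ (e (φ z)) (t z)) :=
      fun z hz => (hα z hz.1).trans (htr _ hz.2 (hVe₀ hz.1) _)
    have hopen : IsOpen (V ∩ φ ⁻¹' e.source) := hV.inter (e.open_source.preimage hφ.continuous)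
    have hst : ∀ z ∈ V ∩ φ ⁻¹' e.source, s z = θ (e (φ z)) (t z) := fun z hz =>
      covector_injective he hz.2 ((hs z ⟨_, hval z hz⟩).symm.trans (hval z hz))
    refine ⟨hs y ⟨_, hval y ⟨hyV, hye⟩⟩, ?_⟩
    have h1 : ContMDiffOn 𝓘(ℝ, E') 𝓘(ℝ, E) ∞ (fun z => e (φ z)) (V ∩ φ ⁻¹' e.source) :=
      (contMDiffOn_of_mem_maximalAtlas (mem_maximalAtlas he)).comp hφ.contMDiffOn
        fun z hz => hz.2
    have h2 : ContMDiffOn 𝓘(ℝ, E') 𝓘(ℝ, F →L[ℝ] F) ∞ (fun z => θ (e (φ z)))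
        (V ∩ φ ⁻¹' e.source) := by
      refine hθ.contMDiffOn.comp h1 fun z hz => ?_
      have := hVe₀ hz.1
      simp_all [e.left_inv hz.2]
    have h3 := h2.clm_apply (ht.mono Set.inter_subset_left)
    exact (h3.congr hst).contMDiffAt (hopen.mem_nhds ⟨hyV, hye⟩)
  exact ⟨s, fun y hy => (key y hy).2.contMDiffWithinAt, fun y hy => (key y hy).1⟩

/-- The condition on higher derivatives in the definition of `𝔄(U)` is automatic. -/
theorem inAlgebra_iff {U : Set M} (hU : IsOpen U) {f : M → ℝ} :
    B.InAlgebra U f ↔ ContMDiffOn 𝓘(ℝ, E) 𝓘(ℝ, ℝ) ∞ f U ∧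
      B.IsSection U (fun x => mvfderiv 𝓘(ℝ, E) f x) := by
  refine ⟨fun h => ⟨h.1, h.2.1⟩, fun h => ⟨h.1, h.2, fun e he x hx k u => ?_⟩⟩
  obtain ⟨s, hs, hds⟩ := h.2 e he
  have hA := mem_maximalAtlas he
  have hO : IsOpen (e.target ∩ e.symm ⁻¹' (U ∩ e.source)) :=
    e.symm.isOpen_inter_preimage (hU.inter e.open_source)
  have hs' : ContDiffOn ℝ ∞ (s ∘ e.symm) (e.target ∩ e.symm ⁻¹' (U ∩ e.source)) :=
    contDiffOn_comp_symm hA hs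
  have hxO : e x ∈ e.target ∩ e.symm ⁻¹' (U ∩ e.source) :=
    ⟨e.map_source hx.2, by simpa [e.left_inv hx.2] using hx⟩
  have hfd : ∀ p ∈ e.target ∩ e.symm ⁻¹' (U ∩ e.source),
      fderiv ℝ (f ∘ e.symm) p = B.incl (s (e.symm p)) := by
    rintro p ⟨hp, hpU⟩
    ext w
    obtain ⟨w, rfl⟩ := (mvfderiv_chart_bijective hA hpU.2).2 w
    have hfd : MDifferentiableAt 𝓘(ℝ, E) 𝓘(ℝ, ℝ) f (e.symm p) :=
      (h.1.contMDiffAt (hU.mem_nhds hpU.1)).mdifferentiableAt (by simp)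
    have := mvfderiv_eq_fderiv_comp hA hpU.2 hfd w
    rw [e.right_inv hp] at this
    rw [← this]
    exact congrArg (fun L : TangentSpace 𝓘(ℝ, E) (e.symm p) →L[ℝ] ℝ => L w)
      (hds (e.symm p) hpU)
  have hev : fderiv ℝ (f ∘ e.symm) =ᶠ[𝓝 (e x)] B.incl ∘ s ∘ e.symm :=
    Filter.eventuallyEq_of_mem (hO.mem_nhds hxO) hfd
  -- Near `e x` the derivative of `f ∘ e.symm` is `incl ∘ s ∘ e.symm`, and the fixed bounded map
  -- `incl` commutes with further differentiation.
  refine ⟨iteratedFDeriv ℝ k (s ∘ e.symm) (e x) u, fun w => ?_⟩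
  rw [iteratedFDeriv_succ_apply_right, Fin.init_snoc, Fin.snoc_last,
    (hev.iteratedFDeriv ℝ k).eq_of_nhds,
    ContinuousLinearMap.iteratedFDeriv_comp_left _ (hs'.contDiffAt (hO.mem_nhds hxO))
      (WithTop.coe_le_coe.2 le_top)]
  rfl

theorem InAlgebra.contMDiffOn {U : Set M} {f : M → ℝ} (h : B.InAlgebra U f) :
    ContMDiffOn 𝓘(ℝ, E) 𝓘(ℝ, ℝ) ∞ f U := h.1

theorem InAlgebra.isSection {U : Set M} {f : M → ℝ} (h : B.InAlgebra U f) :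
    B.IsSection U (fun x => mvfderiv 𝓘(ℝ, E) f x) := h.2.1

end Sections

end WeakSubbundle

/-- A bounded operator whose values belong to the range of a bounded injection factors through
it. -/
theorem exists_clm_factorization {F G H : Type*} [NormedAddCommGroup F] [NormedSpace ℝ F]
    [CompleteSpace F] [NormedAddCommGroup G] [NormedSpace ℝ G] [CompleteSpace G]
    [NormedAddCommGroup H] [NormedSpace ℝ H] (i : F →L[ℝ] H) (hi : Function.Injective i)
    (L : G →L[ℝ] H) (h : ∀ v, ∃ c, i c = L v) : ∃ A : G →L[ℝ] F, ∀ v, i (A v) = L v := by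
  choose c hc using h
  let A : G →ₗ[ℝ] F :=
    { toFun := c
      map_add' := fun v w => hi (by simp [hc])
      map_smul' := fun a v => hi (by simp [hc]) }
  refine ⟨⟨A, ?_⟩, hc⟩
  -- Closed graph theorem: a limit in the graph of `A` can be tested after the injection `i`, where
  -- `i ∘ A = L` is continuous.
  refine A.continuous_of_seq_closed_graph fun u x y hu hy => hi ?_
  have h1 := (i.continuous.tendsto y).comp hy
  have h2 := (L.continuous.tendsto x).comp hu
  have h3 : i ∘ (A ∘ u) = L ∘ u := funext fun n => hc (u n)
  rw [h3] at h1
  exact (tendsto_nhds_unique h1 h2).trans (hc x).symm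

namespace WeakSubbundle

/-! ### A partial Poisson anchor read in a chart -/

section LocalForm

variable {E M F : Type*} [NormedAddCommGroup E] [NormedSpace ℝ E]
  [TopologicalSpace M] [ChartedSpace E M] [NormedAddCommGroup F] [NormedSpace ℝ F]
  {B : WeakSubbundle E M F} {P : B.FiberMap} {e : OpenPartialHomeomorph M E} {x : M}

theorem bracket_eq {f g : M → ℝ} (hg : mvfderiv 𝓘(ℝ, E) g x ∈ B.fiber x) :
    B.bracket P f g x
      = - mvfderiv 𝓘(ℝ, E) f x (P x ⟨mvfderiv 𝓘(ℝ, E) g x, hg⟩) := by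
  rw [bracket, dif_pos hg]

theorem bracket_eq_of_covector {f g : M → ℝ} {v w : F} {u : E} (he : e ∈ B.charts)
    (hx : x ∈ e.source)
    (hP : ∀ h, mvfderiv 𝓘(ℝ, E) (e : M → E) x (P x ⟨B.covector e x w, h⟩) = u)
    (hf : mvfderiv 𝓘(ℝ, E) f x = B.covector e x v)
    (hg : mvfderiv 𝓘(ℝ, E) g x = B.covector e x w) :
    B.bracket P f g x = - B.incl v u := by
  have hmem : mvfderiv 𝓘(ℝ, E) g x ∈ B.fiber x := hg ▸ covector_mem_fiber he hx w
  rw [bracket_eq hmem, hf, covector_apply, ← hP (covector_mem_fiber he hx w)]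
  simp only [hg]

theorem mvfderiv_incl_comp_chart (he : e ∈ B.charts) (hx : x ∈ e.source) (v : F) :
    mvfderiv 𝓘(ℝ, E) (B.incl v ∘ e) x = B.covector e x v := by
  have hm := (mdifferentiable_of_mem_maximalAtlas (mem_maximalAtlas he)).mdifferentiableAt hx
  have hv : MDifferentiableAt 𝓘(ℝ, E) 𝓘(ℝ, ℝ) (B.incl v) (e x) :=
    (B.incl v).differentiableAt.mdifferentiableAt
  ext u
  rw [mvfderiv_comp_eq hv hm]
  have h2 : mfderiv 𝓘(ℝ, E) 𝓘(ℝ, ℝ) (B.incl v) (e x) = B.incl v :=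
    mfderiv_eq_fderiv.trans (B.incl v).fderiv
  exact congrArg (fun L : E →L[ℝ] ℝ => L (mvfderiv 𝓘(ℝ, E) (e : M → E) x u)) h2

/-- The differential has constant coordinate `v` in the chart `e`. These functions are the test
functions which turn the axioms on the bracket into identities for `Q`. -/
theorem inAlgebra_incl_comp_chart (he : e ∈ B.charts) (v : F) :
    B.InAlgebra e.source (B.incl v ∘ e) := by
  refine (inAlgebra_iff e.open_source).2 ⟨?_, ?_⟩
  · exact (B.incl v).contMDiff.comp_contMDiffOn
      (contMDiffOn_of_mem_maximalAtlas (mem_maximalAtlas he))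
  · exact isSectionAlong_of_locally contMDiff_id fun y hy =>
      ⟨e.source, e.open_source, hy, e, he, fun _ h => h, fun _ => v, contMDiffOn_const,
        fun z hz => mvfderiv_incl_comp_chart he hz v⟩

/-- The local form of a partial Poisson anchor. -/
theorem IsPoissonAnchor.exists_isLocalPoisson [CompleteSpace F]
    (hP : B.IsPoissonAnchor P) (he : e ∈ B.charts) :
    ∃ (Q : E → F →L[ℝ] E) (C : E → F →L[ℝ] F →L[ℝ] F), IsLocalPoisson B.incl e.target Q C ∧
      ∀ x ∈ e.source, ∀ v (h : B.covector e x v ∈ B.fiber x),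
        mvfderiv 𝓘(ℝ, E) (e : M → E) x (P x ⟨B.covector e x v, h⟩) = Q (e x) v := by
  obtain ⟨Q, hQs, hQ⟩ := hP.isMorphism e he
  have hA := mem_maximalAtlas he
  have hanti : ∀ p ∈ e.target, ∀ u v, B.incl u (Q p v) = - B.incl v (Q p u) := by
    intro p hp u v
    have hx := e.map_target hp
    have := hP.isAntisymm (e.symm p) ⟨_, covector_mem_fiber he hx u⟩
      ⟨_, covector_mem_fiber he hx v⟩
    simpa only [covector_apply, hQ _ hx, e.right_inv hp] using this
  have hbr : ∀ u v, ∀ x ∈ e.source,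
      B.bracket P (B.incl u ∘ e) (B.incl v ∘ e) x = - B.incl u (Q (e x) v) := fun u v x hx =>
    bracket_eq_of_covector he hx (hQ x hx v) (mvfderiv_incl_comp_chart he hx u)
      (mvfderiv_incl_comp_chart he hx v)
  have hQd : ∀ p ∈ e.target, HasFDerivAt Q (fderiv ℝ Q p) p := fun p hp =>
    ((hQs.contDiffAt (e.open_target.mem_nhds hp)).differentiableAt (by simp)).hasFDerivAt
  -- The bracket of two test functions is `-⟨u, Q v⟩`. As it lies in `𝔄`, the covector `w ↦ ⟨u,
  -- DQ(w) v⟩` has a smooth coordinate `c` in `F`.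
  have hdbr : ∀ u v, ∃ c : E → F, ContDiffOn ℝ ∞ c e.target ∧
      (∀ p ∈ e.target, ∀ w, B.incl (c p) w = B.incl u (fderiv ℝ Q p w v)) ∧
      ∀ x ∈ e.source, mvfderiv 𝓘(ℝ, E) (B.bracket P (B.incl u ∘ e) (B.incl v ∘ e)) x
        = - B.covector e x (c (e x)) := by
    intro u v
    have hmem := hP.bracket_mem e.source e.open_source _ _ (inAlgebra_incl_comp_chart he u)
      (inAlgebra_incl_comp_chart he v)
    obtain ⟨s, hs, hds⟩ := hmem.isSection e he
    have hs' := contDiffOn_comp_symm hA hs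
    refine ⟨fun p => - s (e.symm p), (hs'.mono fun p hp => ?_).neg, fun p hp w => ?_,
      fun x hx => ?_⟩
    · exact ⟨hp, e.map_target hp, e.map_target hp⟩
    · have hx := e.map_target hp
      obtain ⟨w, rfl⟩ := (mvfderiv_chart_bijective hA hx).2 w
      have h1 := congrArg (fun L : TangentSpace 𝓘(ℝ, E) (e.symm p) →L[ℝ] ℝ => L w)
        (hds (e.symm p) ⟨hx, hx⟩)
      dsimp only at h1
      rw [mvfderiv_eq_fderiv_comp hA hx ((hmem.contMDiffOn.contMDiffAt
        (e.open_source.mem_nhds hx)).mdifferentiableAt (by simp)), e.right_inv hp] at h1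
      have hev : (B.bracket P (B.incl u ∘ e) (B.incl v ∘ e)) ∘ e.symm
          =ᶠ[𝓝 p] fun q => - B.incl u (Q q v) :=
        Filter.eventuallyEq_of_mem (e.open_target.mem_nhds hp) fun q hq => by
          rw [Function.comp_apply, hbr u v _ (e.map_target hq), e.right_inv hq]
      have hd : HasFDerivAt (fun q => - B.incl u (Q q v))
          (-((B.incl u).comp ((fderiv ℝ Q p).flip v))) p := by
        have := ((hQd p hp).clm_apply (hasFDerivAt_const v p))
        rw [ContinuousLinearMap.comp_zero, zero_add] at this
        exact ((B.incl u).hasFDerivAt.comp p this).neg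
      rw [hev.fderiv_eq, hd.fderiv] at h1
      have h2 : B.covector e (e.symm p) (s (e.symm p)) w
          = B.incl (s (e.symm p)) (mvfderiv 𝓘(ℝ, E) (e : M → E) (e.symm p) w) := rfl
      rw [h2] at h1
      simp [← h1]
    · refine (hds x ⟨hx, hx⟩).trans ?_
      ext w
      simp [covector_apply, e.left_inv hx]
  choose c hcs hc hdc using hdbr
  have hC : ∀ p, ∃ C : F →L[ℝ] F →L[ℝ] F, p ∈ e.target →
      ∀ u v w, B.incl (C u v) w = B.incl u (fderiv ℝ Q p w v) := by
    intro p
    by_cases hp : p ∈ e.target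
    · let D : F →L[ℝ] E →L[ℝ] E := (fderiv ℝ Q p).flip
      let j : (F →L[ℝ] F) →L[ℝ] (F →L[ℝ] E →L[ℝ] ℝ) := ContinuousLinearMap.postcomp F B.incl
      let L : F →L[ℝ] F →L[ℝ] E →L[ℝ] ℝ := (ContinuousLinearMap.precomp (E →L[ℝ] ℝ) D).comp
        ((ContinuousLinearMap.compL ℝ E E ℝ).comp B.incl)
      have hj : Function.Injective j := by
        intro A₁ A₂ h
        ext v
        exact B.incl_injective (congrArg (fun L : F →L[ℝ] E →L[ℝ] ℝ => L v) h)
      have hex : ∀ u, ∃ A, j A = L u := fun u => by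
        obtain ⟨A, hA⟩ := exists_clm_factorization B.incl B.incl_injective (L u) fun v =>
          ⟨c u v p, ContinuousLinearMap.ext fun w => hc u v p hp w⟩
        refine ⟨A, ?_⟩
        ext v : 1
        exact hA v
      obtain ⟨C, hC⟩ := exists_clm_factorization (F := F →L[ℝ] F) (H := F →L[ℝ] E →L[ℝ] ℝ)
        j hj L hex
      refine ⟨C, fun _ u v w => ?_⟩
      exact congrArg (fun L : F →L[ℝ] E →L[ℝ] ℝ => L v w) (hC u)
    · exact ⟨0, fun h => absurd h hp⟩
  choose C hC using hC
  have hCc : ∀ p ∈ e.target, ∀ u v, C p u v = c u v p := fun p hp u v =>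
    B.incl_injective (ContinuousLinearMap.ext fun w => (hC p hp u v w).trans (hc u v p hp w).symm)
  refine ⟨Q, C, ⟨e.open_target, hQs, ?_, hanti, hC, ?_⟩, hQ⟩
  · exact contDiffOn_clm_of_forall_apply e.open_target fun u =>
      contDiffOn_clm_of_forall_apply e.open_target fun v =>
        (hcs u v).congr fun p hp => hCc p hp u v
  · intro p hp u v w
    have hx := e.map_target hp
    have hj := hP.jacobi e.source e.open_source _ _ _ (inAlgebra_incl_comp_chart he v)
      (inAlgebra_incl_comp_chart he u) (inAlgebra_incl_comp_chart he w) _ hx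
    have hneg : ∀ a b, mvfderiv 𝓘(ℝ, E) (B.bracket P (B.incl a ∘ e) (B.incl b ∘ e)) (e.symm p)
        = B.covector e (e.symm p) (- c a b p) := fun a b => by
      rw [hdc a b _ hx, e.right_inv hp]
      ext z
      simp [covector_apply]
    have hval : ∀ k a b, B.bracket P (B.incl k ∘ e) (B.bracket P (B.incl a ∘ e) (B.incl b ∘ e))
        (e.symm p) = - B.incl a (fderiv ℝ Q p (Q p k) b) := fun k a b => by
      rw [bracket_eq_of_covector he hx (hQ _ hx _) (mvfderiv_incl_comp_chart he hx k) (hneg a b),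
        e.right_inv hp, hanti p hp, neg_neg, map_neg, neg_apply, hc a b p hp]
    rw [hval, hval, hval] at hj
    linarith

end LocalForm

end WeakSubbundle

/-! ### Pointwise existence and uniqueness of the restricted anchor -/

section Restriction

open WeakSubbundle

variable {E M F E' N F' : Type*}
  [NormedAddCommGroup E] [NormedSpace ℝ E] [TopologicalSpace M] [ChartedSpace E M]
  [NormedAddCommGroup F] [NormedSpace ℝ F]
  [NormedAddCommGroup E'] [NormedSpace ℝ E'] [TopologicalSpace N] [ChartedSpace E' N]
  [NormedAddCommGroup F'] [NormedSpace ℝ F']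
  {B : WeakSubbundle E M F} {P : B.FiberMap} {B' : WeakSubbundle E' N F'} {φ : N → M}

theorem contMDiff_of_isImmersionAt [IsManifold 𝓘(ℝ, E) ∞ M] [IsManifold 𝓘(ℝ, E') ∞ N]
    (hφ : ∀ y : N, Manifold.IsImmersionAt 𝓘(ℝ, E') 𝓘(ℝ, E) ∞ φ y) :
    ContMDiff 𝓘(ℝ, E') 𝓘(ℝ, E) ∞ φ := fun y => (hφ y).contMDiffAt

/-- The differential of an immersion has, in charts, a smooth left inverse. -/
theorem exists_smooth_left_inverse_fderiv [IsManifold 𝓘(ℝ, E) ∞ M] [IsManifold 𝓘(ℝ, E') ∞ N]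
    (hφ : ∀ y : N, Manifold.IsImmersionAt 𝓘(ℝ, E') 𝓘(ℝ, E) ∞ φ y)
    {e : OpenPartialHomeomorph M E} (he : e ∈ IsManifold.maximalAtlas 𝓘(ℝ, E) ∞ M)
    {e' : OpenPartialHomeomorph N E'} (he' : e' ∈ IsManifold.maximalAtlas 𝓘(ℝ, E') ∞ N) {y : N}
    (hy : y ∈ e'.source) (hye : φ y ∈ e.source) :
    ∃ W : Set E', IsOpen W ∧ e' y ∈ W ∧ W ⊆ e'.target ∧ (∀ p ∈ W, φ (e'.symm p) ∈ e.source) ∧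
      ContDiffOn ℝ ∞ (e ∘ φ ∘ e'.symm) W ∧
      ∃ l : E' → E →L[ℝ] E', ContDiffOn ℝ ∞ l W ∧
        ∀ p ∈ W, ∀ w, l p (fderiv ℝ (e ∘ φ ∘ e'.symm) p w) = w := by
  have hφs := contMDiff_of_isImmersionAt hφ
  obtain ⟨ρ, O, hO, hyO, hρ, V, hV, hyV, hVρ⟩ := exists_left_inverse_of_isImmersionAt (hφ y)
  have hS : IsOpen (V ∩ φ ⁻¹' e.source ∩ e'.source) :=
    (hV.inter (e.open_source.preimage hφs.continuous)).inter e'.open_source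
  let W : Set E' := e'.target ∩ e'.symm ⁻¹' (V ∩ φ ⁻¹' e.source ∩ e'.source)
  have hW : IsOpen W := e'.symm.isOpen_inter_preimage hS
  have hρV : IsOpen (O ∩ ρ ⁻¹' e'.source) := hρ.continuousOn.isOpen_inter_preimage hO e'.open_source
  have hφW : ContDiffOn ℝ ∞ (e ∘ φ ∘ e'.symm) W := by
    have h1 : ContMDiffOn 𝓘(ℝ, E') 𝓘(ℝ, E) ∞ (e ∘ φ) (V ∩ φ ⁻¹' e.source ∩ e'.source) :=
      (contMDiffOn_of_mem_maximalAtlas he).comp hφs.contMDiffOn fun z hz => hz.1.2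
    exact contDiffOn_comp_symm he' h1
  let T : Set E := e.target ∩ e.symm ⁻¹' (O ∩ ρ ⁻¹' e'.source)
  have hT : IsOpen T := e.symm.isOpen_inter_preimage hρV
  have hρT : ContDiffOn ℝ ∞ (e' ∘ ρ ∘ e.symm) T := by
    have h1 : ContMDiffOn 𝓘(ℝ, E) 𝓘(ℝ, E') ∞ (e' ∘ ρ) (O ∩ ρ ⁻¹' e'.source) :=
      (contMDiffOn_of_mem_maximalAtlas he').comp (hρ.mono Set.inter_subset_left) fun z hz => hz.2
    exact contDiffOn_comp_symm he h1
  have hmaps : Set.MapsTo (e ∘ φ ∘ e'.symm) W T := by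
    rintro p ⟨hp, ⟨hpV, hpe⟩, hpe'⟩
    refine ⟨e.map_source hpe, ?_⟩
    simp only [Function.comp_apply, Set.mem_preimage, e.left_inv hpe]
    refine ⟨(hVρ _ hpV).1, ?_⟩
    rw [Set.mem_preimage, (hVρ _ hpV).2]
    exact hpe'
  refine ⟨W, hW, ⟨e'.map_source hy, ?_⟩, Set.inter_subset_left, fun p hp => hp.2.1.2, hφW,
    fun p => fderiv ℝ (e' ∘ ρ ∘ e.symm) ((e ∘ φ ∘ e'.symm) p), ?_, fun p hp w => ?_⟩
  · rw [Set.mem_preimage, e'.left_inv hy]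
    exact ⟨⟨hyV, hye⟩, hy⟩
  · exact ((contDiffOn_infty_iff_fderiv_of_isOpen hT).1 hρT).2.comp hφW hmaps
  · have h1 : DifferentiableAt ℝ (e ∘ φ ∘ e'.symm) p :=
      (hφW.contDiffAt (hW.mem_nhds hp)).differentiableAt (by simp)
    have h2 : DifferentiableAt ℝ (e' ∘ ρ ∘ e.symm) ((e ∘ φ ∘ e'.symm) p) :=
      (hρT.contDiffAt (hT.mem_nhds (hmaps hp))).differentiableAt (by simp)
    have h3 : (e' ∘ ρ ∘ e.symm) ∘ (e ∘ φ ∘ e'.symm) =ᶠ[𝓝 p] id := by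
      refine Filter.eventuallyEq_of_mem (hW.mem_nhds hp) ?_
      rintro q ⟨hq, ⟨hqV, hqe⟩, hqe'⟩
      simp only [Set.mem_preimage] at hqe
      simp [e.left_inv hqe, (hVρ _ hqV).2, e'.right_inv hq]
    have h4 := fderiv_comp p h2 h1
    rw [h3.fderiv_eq, fderiv_id] at h4
    exact (congrArg (fun L : E' →L[ℝ] E' => L w) h4).symm

theorem mfderiv_injective_of_isImmersionAt [IsManifold 𝓘(ℝ, E) ∞ M] [IsManifold 𝓘(ℝ, E') ∞ N]
    (hφ : ∀ y : N, Manifold.IsImmersionAt 𝓘(ℝ, E') 𝓘(ℝ, E) ∞ φ y) (y : N) :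
    Function.Injective (mfderiv 𝓘(ℝ, E') 𝓘(ℝ, E) φ y) := by
  have he := IsManifold.chart_mem_maximalAtlas (I := 𝓘(ℝ, E)) (n := ∞) (φ y)
  have he' := IsManifold.chart_mem_maximalAtlas (I := 𝓘(ℝ, E')) (n := ∞) y
  obtain ⟨W, -, hyW, -, -, -, l, -, hl⟩ := exists_smooth_left_inverse_fderiv hφ he he'
    (mem_chart_source E' y) (mem_chart_source E (φ y))
  intro u v huv
  have hφy : MDifferentiableAt 𝓘(ℝ, E') 𝓘(ℝ, E) φ y :=
    (hφ y).contMDiffAt.mdifferentiableAt (by simp)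
  apply (mvfderiv_chart_bijective he' (mem_chart_source E' y)).1
  rw [← hl _ hyW (mvfderiv 𝓘(ℝ, E') _ y u), ← hl _ hyW (mvfderiv 𝓘(ℝ, E') _ y v),
    ← mvfderiv_chart_mfderiv he he' hφy (mem_chart_source E' y) (mem_chart_source E (φ y)),
    ← mvfderiv_chart_mfderiv he he' hφy (mem_chart_source E' y) (mem_chart_source E (φ y)), huv]

theorem WeakSubbundle.isSection_of_contDiffOn {e' : OpenPartialHomeomorph N E'}
    (he' : e' ∈ B'.charts) {β : E' → F'} (hβ : ContDiffOn ℝ ∞ β e'.target) :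
    B'.IsSection e'.source (fun z => B'.covector e' z (β (e' z))) :=
  isSectionAlong_of_locally contMDiff_id fun _ hy =>
    ⟨e'.source, e'.open_source, hy, e', he', fun _ h => h, fun z => β (e' z),
      (contMDiffOn_comp_chart (mem_maximalAtlas he') hβ).mono
        fun _ hz => ⟨hz, e'.map_source hz⟩, fun _ _ => rfl⟩

theorem pull_smul_add {α β : ∀ y : N, TangentSpace 𝓘(ℝ, E) (φ y) →L[ℝ] ℝ} (c : ℝ) (y : N) :
    pull (E' := E') φ (fun z => c • α z + β z) y = c • pull φ α y + pull φ β y := by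
  ext u
  simp [pull]

variable {U V : Set N} {α β : ∀ y : N, TangentSpace 𝓘(ℝ, E) (φ y) →L[ℝ] ℝ}

theorem IsTangentSection.mono (h : IsTangentSection (E' := E') B P φ U α) (hVU : V ⊆ U) :
    IsTangentSection (E' := E') B P φ V α :=
  ⟨h.1.mono hVU, fun y hy => h.2 y (hVU hy)⟩

theorem WeakSubbundle.FiberMap.map_smul_add {x : M} (c : ℝ)
    {ξ η : TangentSpace 𝓘(ℝ, E) x →L[ℝ] ℝ} (hξ : ξ ∈ B.fiber x) (hη : η ∈ B.fiber x)
    (h : c • ξ + η ∈ B.fiber x) :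
    P x ⟨c • ξ + η, h⟩ = c • P x ⟨ξ, hξ⟩ + P x ⟨η, hη⟩ := by
  rw [← map_smul, ← map_add]
  rfl

theorem IsTangentSection.smul_add (hα : IsTangentSection (E' := E') B P φ U α)
    (hβ : IsTangentSection (E' := E') B P φ U β) (c : ℝ) :
    IsTangentSection (E' := E') B P φ U (fun y => c • α y + β y) := by
  refine ⟨hα.1.smul_add hβ.1 c, fun y hy h => ?_⟩
  obtain ⟨u, hu⟩ := hα.2 y hy (hα.1.mem_fiber hy)
  obtain ⟨v, hv⟩ := hβ.2 y hy (hβ.1.mem_fiber hy)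
  refine ⟨c • u + v, ?_⟩
  rw [map_add, map_smul, hu, hv]
  exact (FiberMap.map_smul_add (P := P) c _ _ h).symm

/-- Sections of `T♭N` lift locally to tangent sections. -/
theorem exists_isTangentSection_of_isSection (hB' : IsRestriction B B' φ)
    (h1 : RpP1 (E' := E') B P φ) (hU : IsOpen U)
    {β : ∀ y : N, TangentSpace 𝓘(ℝ, E') y →L[ℝ] ℝ} (hβ : B'.IsSection U β) {y : N} (hy : y ∈ U) :
    ∃ V ⊆ U, IsOpen V ∧ y ∈ V ∧ ∃ α : (∀ z : N, TangentSpace 𝓘(ℝ, E) (φ z) →L[ℝ] ℝ),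
      IsTangentSection (E' := E') B P φ V α ∧ ∀ z ∈ V, pull φ α z = β z := by
  obtain ⟨V, hVU, hV, hyV, α, hα, hαβ⟩ := hB'.2 U hU β hβ y hy
  obtain ⟨V', hV'V, hV', hyV', α₁, α₂, hα₁, hα₂, hsum⟩ := h1 V hV α hα y hyV
  refine ⟨V', hV'V.trans hVU, hV', hyV', α₁, hα₁, fun z hz => ?_⟩
  rw [← hαβ z (hV'V hz)]
  ext u
  have := hα₂.2 z hz u
  simp only [pull, ContinuousLinearMap.comp_apply, hsum z hz, add_apply, this, add_zero]

/-- The covector is extended with constant coordinate in a chart and the extension is lifted. Local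
lifting is an assumption here so that both (RpP1) and the first half of `IsRestrictedAnchor` can
supply it. -/
theorem exists_isTangentSection_of_mem_fiber
    (hlift : ∀ U : Set N, IsOpen U → ∀ β : (∀ y : N, TangentSpace 𝓘(ℝ, E') y →L[ℝ] ℝ),
      B'.IsSection U β → ∀ y ∈ U, ∃ V ⊆ U, IsOpen V ∧ y ∈ V ∧
        ∃ α : (∀ z : N, TangentSpace 𝓘(ℝ, E) (φ z) →L[ℝ] ℝ),
          IsTangentSection (E' := E') B P φ V α ∧ ∀ z ∈ V, pull φ α z = β z)
    {y : N} {ξ : TangentSpace 𝓘(ℝ, E') y →L[ℝ] ℝ} (hξ : ξ ∈ B'.fiber y) :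
    ∃ V, IsOpen V ∧ y ∈ V ∧ ∃ α : (∀ z : N, TangentSpace 𝓘(ℝ, E) (φ z) →L[ℝ] ℝ),
      IsTangentSection (E' := E') B P φ V α ∧ pull φ α y = ξ := by
  obtain ⟨e', he', hy⟩ := B'.exists_chart y
  obtain ⟨v, rfl⟩ := hξ e' he' hy
  obtain ⟨V, -, hV, hyV, α, hα, hαβ⟩ := hlift e'.source e'.open_source _
    (isSection_of_contDiffOn he' (β := fun _ => v) contDiffOn_const) y hy
  exact ⟨V, hV, hyV, α, hα, hαβ y hyV⟩

/-- There is at most one restricted anchor. -/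
theorem IsRestrictedAnchor.unique [IsManifold 𝓘(ℝ, E) ∞ M] [IsManifold 𝓘(ℝ, E') ∞ N]
    (hφ : ∀ y : N, Manifold.IsImmersionAt 𝓘(ℝ, E') 𝓘(ℝ, E) ∞ φ y) {P₁ P₂ : B'.FiberMap}
    (h₁ : IsRestrictedAnchor B P B' P₁ φ) (h₂ : IsRestrictedAnchor B P B' P₂ φ) : P₁ = P₂ := by
  funext y
  ext ⟨ξ, hξ⟩ : 1
  obtain ⟨V, hV, hyV, α, hα, rfl⟩ := exists_isTangentSection_of_mem_fiber h₁.1 hξ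
  have hmem := hα.1.mem_fiber hyV
  exact mfderiv_injective_of_isImmersionAt hφ y
    ((h₁.2 V hV α hα y hyV hmem hξ).trans (h₂.2 V hV α hα y hyV hmem hξ).symm)

/-- The restricted anchor exists as a family of linear maps. -/
theorem exists_isRestrictedAnchor [IsManifold 𝓘(ℝ, E) ∞ M] [IsManifold 𝓘(ℝ, E') ∞ N]
    (hφ : ∀ y : N, Manifold.IsImmersionAt 𝓘(ℝ, E') 𝓘(ℝ, E) ∞ φ y) (hB' : IsRestriction B B' φ)
    (h1 : RpP1 (E' := E') B P φ) (h2 : RpP2 (E' := E') B P φ) :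
    ∃ P' : B'.FiberMap, IsRestrictedAnchor B P B' P' φ := by
  have hlift := fun U hU β hβ y hy =>
    exists_isTangentSection_of_isSection (U := U) (β := β) (y := y) hB' h1 hU hβ hy
  have hex : ∀ (y : N) (ξ : B'.fiber y), ∃ u : TangentSpace 𝓘(ℝ, E') y,
      ∀ U, IsOpen U → y ∈ U → ∀ α : (∀ z : N, TangentSpace 𝓘(ℝ, E) (φ z) →L[ℝ] ℝ),
        IsTangentSection (E' := E') B P φ U α → pull φ α y = ξ.1 → ∀ h : α y ∈ B.fiber (φ y),
          mfderiv 𝓘(ℝ, E') 𝓘(ℝ, E) φ y u = P (φ y) ⟨α y, h⟩ := by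
    rintro y ⟨ξ, hξ⟩
    obtain ⟨V, hV, hyV, α, hα, rfl⟩ := exists_isTangentSection_of_mem_fiber hlift hξ
    obtain ⟨u, hu⟩ := hα.2 y hyV (hα.1.mem_fiber hyV)
    refine ⟨u, fun U hU hyU β hβ hpull h => hu.trans ?_⟩
    -- The difference `-α + β` of two lifts of the same covector annihilates the tangent space at
    -- `y`, so (RpP2) applies to it.
    have hd := (hα.mono Set.inter_subset_right).smul_add (hβ.mono (Set.inter_subset_left (t := V)))
      (-1)
    have h0 := h2 _ (hU.inter hV) _ hd y ⟨hyU, hyV⟩ (fun w => by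
      have := congrArg (fun L : TangentSpace 𝓘(ℝ, E') y →L[ℝ] ℝ => L w) hpull
      simp only [pull, ContinuousLinearMap.comp_apply] at this
      simp [this]) (hd.1.mem_fiber ⟨hyU, hyV⟩)
    rw [FiberMap.map_smul_add (P := P) (-1) (hα.1.mem_fiber hyV) h, neg_one_smul,
      neg_add_eq_zero] at h0
    exact h0
  choose p hp using hex
  have hinj := mfderiv_injective_of_isImmersionAt hφ
  have hlin : ∀ (y : N) (c : ℝ) (ξ η : B'.fiber y), p y (c • ξ + η) = c • p y ξ + p y η := by
    intro y c ξ η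
    obtain ⟨V, hV, hyV, α, hα, hαξ⟩ := exists_isTangentSection_of_mem_fiber hlift ξ.2
    obtain ⟨U, hU, hyU, β, hβ, hβη⟩ := exists_isTangentSection_of_mem_fiber hlift η.2
    have hα' := hα.mono (Set.inter_subset_left (t := U))
    have hβ' := hβ.mono (Set.inter_subset_right (s := V))
    have hy : y ∈ V ∩ U := ⟨hyV, hyU⟩
    have hs := hα'.smul_add hβ' c
    have e1 := hp y (c • ξ + η) _ (hV.inter hU) hy _ hs
      (by rw [pull_smul_add, hαξ, hβη]; rfl) (hs.1.mem_fiber hy)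
    have e2 := hp y ξ _ (hV.inter hU) hy _ hα' hαξ (hα'.1.mem_fiber hy)
    have e3 := hp y η _ (hV.inter hU) hy _ hβ' hβη (hβ'.1.mem_fiber hy)
    apply hinj y
    rw [map_add, map_smul, e1, e2, e3]
    exact FiberMap.map_smul_add (P := P) c _ _ _
  refine ⟨fun y =>
    { toFun := p y
      map_add' := fun ξ η => by simpa using hlin y 1 ξ η
      map_smul' := fun c ξ => by
        have h0 : p y 0 = 0 := by simpa using hlin y 1 0 0
        simpa [h0] using hlin y c ξ 0 }, hlift, ?_⟩
  intro U hU α hα y hy h h'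
  exact hp y ⟨pull φ α y, h'⟩ U hU hy α hα rfl h

end Restriction

/-! ### Antisymmetry and smoothness of the restricted anchor -/

section RestrictedAnchor

open WeakSubbundle

variable {E M F E' N F' : Type*}
  [NormedAddCommGroup E] [NormedSpace ℝ E] [TopologicalSpace M] [ChartedSpace E M]
  [NormedAddCommGroup F] [NormedSpace ℝ F]
  [NormedAddCommGroup E'] [NormedSpace ℝ E'] [TopologicalSpace N] [ChartedSpace E' N]
  [NormedAddCommGroup F'] [NormedSpace ℝ F']
  {B : WeakSubbundle E M F} {P : B.FiberMap} {B' : WeakSubbundle E' N F'} {P' : B'.FiberMap}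
  {φ : N → M}

theorem IsRestrictedAnchor.isAntisymm (hP : B.IsAntisymm P) (hR : IsRestrictedAnchor B P B' P' φ) :
    B'.IsAntisymm P' := by
  rintro y ⟨ξ, hξ⟩ ⟨η, hη⟩
  obtain ⟨V, hV, hyV, α, hα, rfl⟩ := exists_isTangentSection_of_mem_fiber hR.1 hξ
  obtain ⟨U, hU, hyU, β, hβ, rfl⟩ := exists_isTangentSection_of_mem_fiber hR.1 hη
  change α y (mfderiv 𝓘(ℝ, E') 𝓘(ℝ, E) φ y _) = - β y (mfderiv 𝓘(ℝ, E') 𝓘(ℝ, E) φ y _)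
  rw [hR.2 U hU β hβ y hyU (hβ.1.mem_fiber hyU) hη, hR.2 V hV α hα y hyV (hα.1.mem_fiber hyV) hξ]
  exact hP (φ y) ⟨α y, hα.1.mem_fiber hyV⟩ ⟨β y, hβ.1.mem_fiber hyU⟩

open Classical in
/-- The vector field `P' β` in the chart `e'`. -/
def chartField (P' : B'.FiberMap) (e' : OpenPartialHomeomorph N E')
    (β : ∀ y : N, TangentSpace 𝓘(ℝ, E') y →L[ℝ] ℝ) (p : E') : E' :=
  if h : β (e'.symm p) ∈ B'.fiber (e'.symm p) then
    mvfderiv 𝓘(ℝ, E') (e' : N → E') (e'.symm p) (P' (e'.symm p) ⟨β (e'.symm p), h⟩)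
  else 0

variable {e : OpenPartialHomeomorph M E} {e' : OpenPartialHomeomorph N E'} {Q : E → F →L[ℝ] E}
  {β : ∀ y : N, TangentSpace 𝓘(ℝ, E') y →L[ℝ] ℝ} {U : Set N} {y : N}

theorem chartField_eq {p : E'} (h : β (e'.symm p) ∈ B'.fiber (e'.symm p)) :
    chartField P' e' β p
      = mvfderiv 𝓘(ℝ, E') (e' : N → E') (e'.symm p) (P' (e'.symm p) ⟨β (e'.symm p), h⟩) :=
  dif_pos h

/-- Sections of `T♭N` lift locally to tangent sections, in charts. -/
theorem IsRestrictedAnchor.exists_chart_lift [IsManifold 𝓘(ℝ, E) ∞ M] [IsManifold 𝓘(ℝ, E') ∞ N]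
    (hφ : ∀ y : N, Manifold.IsImmersionAt 𝓘(ℝ, E') 𝓘(ℝ, E) ∞ φ y)
    (hR : IsRestrictedAnchor B P B' P' φ) (he : e ∈ B.charts) (he' : e' ∈ B'.charts)
    (hQs : ContDiffOn ℝ ∞ Q e.target)
    (hQ : ∀ x ∈ e.source, ∀ v (h : B.covector e x v ∈ B.fiber x),
        mvfderiv 𝓘(ℝ, E) (e : M → E) x (P x ⟨B.covector e x v, h⟩) = Q (e x) v)
    (hU : IsOpen U) (hβ : B'.IsSection U β) (hy : y ∈ U) (hye' : y ∈ e'.source)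
    (hye : φ y ∈ e.source) :
    ∃ W, IsOpen W ∧ e' y ∈ W ∧ W ⊆ e'.target ∩ e'.symm ⁻¹' U ∧
      (∀ p ∈ W, φ (e'.symm p) ∈ e.source) ∧ ContDiffOn ℝ ∞ (e ∘ φ ∘ e'.symm) W ∧
      ContDiffOn ℝ ∞ (chartField P' e' β) W ∧ ∃ a : E' → F, ContDiffOn ℝ ∞ a W ∧
        (∀ p ∈ W, ∀ u, β (e'.symm p) u = B.incl (a p) (fderiv ℝ (e ∘ φ ∘ e'.symm) p
          (mvfderiv 𝓘(ℝ, E') (e' : N → E') (e'.symm p) u))) ∧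
        ∀ p ∈ W, fderiv ℝ (e ∘ φ ∘ e'.symm) p (chartField P' e' β p)
          = Q ((e ∘ φ ∘ e'.symm) p) (a p) := by
  have hA := mem_maximalAtlas he
  have hA' := mem_maximalAtlas he'
  have hφs := contMDiff_of_isImmersionAt hφ
  obtain ⟨W₀, hW₀, hyW₀, hW₀t, hW₀e, hφW, l, hl, hlφ⟩ :=
    exists_smooth_left_inverse_fderiv hφ hA hA' hye' hye
  obtain ⟨V, hVU, hV, hyV, α, hα, hαβ⟩ := hR.1 U hU β hβ y hy
  obtain ⟨s, hs, hsα⟩ := hα.1 e he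
  have hVe : IsOpen (V ∩ φ ⁻¹' e.source) := hV.inter (e.open_source.preimage hφs.continuous)
  have hWo : IsOpen (e'.target ∩ e'.symm ⁻¹' (V ∩ φ ⁻¹' e.source)) :=
    e'.symm.isOpen_inter_preimage hVe
  let W := W₀ ∩ (e'.target ∩ e'.symm ⁻¹' (V ∩ φ ⁻¹' e.source))
  have hφd : ∀ z, MDifferentiableAt 𝓘(ℝ, E') 𝓘(ℝ, E) φ z := fun z =>
    (hφs z).mdifferentiableAt (by simp)
  have hchart : ∀ p ∈ W, ∀ u, mvfderiv 𝓘(ℝ, E) (e : M → E) (φ (e'.symm p))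
      (mfderiv 𝓘(ℝ, E') 𝓘(ℝ, E) φ (e'.symm p) u) = fderiv ℝ (e ∘ φ ∘ e'.symm) p
        (mvfderiv 𝓘(ℝ, E') (e' : N → E') (e'.symm p) u) := by
    intro p hp u
    have := mvfderiv_chart_mfderiv hA hA' (hφd (e'.symm p)) (e'.map_target hp.2.1) hp.2.2.2 u
    rwa [e'.right_inv hp.2.1] at this
  have ha : ContDiffOn ℝ ∞ (s ∘ e'.symm) W :=
    (contDiffOn_comp_symm hA' hs).mono Set.inter_subset_right
  have hfield : ∀ p ∈ W, fderiv ℝ (e ∘ φ ∘ e'.symm) p (chartField P' e' β p)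
      = Q ((e ∘ φ ∘ e'.symm) p) ((s ∘ e'.symm) p) := by
    intro p hp
    have hz := hp.2.2.1
    have hmem : β (e'.symm p) ∈ B'.fiber (e'.symm p) := hβ.mem_fiber (hVU hz)
    rw [chartField_eq hmem, ← hchart p hp]
    have hmem' := hα.1.mem_fiber hz
    have h1 := hR.2 V hV α hα _ hz hmem' (by rw [hαβ _ hz]; exact hmem)
    simp only [hαβ _ hz] at h1
    rw [h1]
    simp only [hsα _ hp.2.2]
    exact hQ _ hp.2.2.2 _ _
  refine ⟨W, hW₀.inter hWo, ⟨hyW₀, e'.map_source hye', ?_⟩, fun p hp => ⟨hp.2.1, hVU hp.2.2.1⟩,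
    fun p hp => hp.2.2.2, hφW.mono Set.inter_subset_left, ?_, s ∘ e'.symm, ha, fun p hp u => ?_,
    hfield⟩
  · rw [Set.mem_preimage, e'.left_inv hye']
    exact ⟨hyV, hye⟩
  -- The left inverse `l` of the differential recovers the field from `Q a`, a smooth expression.
  · have h1 : ContDiffOn ℝ ∞ (fun p => l p (Q ((e ∘ φ ∘ e'.symm) p) ((s ∘ e'.symm) p))) W :=
      (hl.mono Set.inter_subset_left).clm_apply ((hQs.comp (hφW.mono Set.inter_subset_left)
        fun p hp => e.map_source hp.2.2.2).clm_apply ha)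
    exact h1.congr fun p hp => by rw [← hfield p hp, hlφ p hp.1]
  · rw [← hαβ _ hp.2.2.1, ← hchart p hp]
    exact congrArg (fun L : TangentSpace 𝓘(ℝ, E) (φ (e'.symm p)) →L[ℝ] ℝ =>
      L (mfderiv 𝓘(ℝ, E') 𝓘(ℝ, E) φ (e'.symm p) u)) (hsα _ hp.2.2)

theorem IsRestrictedAnchor.contDiffOn_chartField [IsManifold 𝓘(ℝ, E) ∞ M]
    [IsManifold 𝓘(ℝ, E') ∞ N] (hφ : ∀ y : N, Manifold.IsImmersionAt 𝓘(ℝ, E') 𝓘(ℝ, E) ∞ φ y)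
    (hP : B.IsMorphism P) (hR : IsRestrictedAnchor B P B' P' φ) (he' : e' ∈ B'.charts)
    (hU : IsOpen U) (hβ : B'.IsSection U β) :
    ContDiffOn ℝ ∞ (chartField P' e' β) (e'.target ∩ e'.symm ⁻¹' U) := by
  rintro p ⟨hp, hpU⟩
  obtain ⟨e, he, hye⟩ := B.exists_chart (φ (e'.symm p))
  obtain ⟨Q, hQs, hQ⟩ := hP e he
  obtain ⟨W, hW, hyW, -, -, -, hX, -⟩ :=
    hR.exists_chart_lift hφ he he' hQs hQ hU hβ hpU (e'.map_target hp) hye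
  rw [e'.right_inv hp] at hyW
  exact (hX.contDiffAt (hW.mem_nhds hyW)).contDiffWithinAt

/-- The restricted anchor is a smooth bundle morphism. -/
theorem IsRestrictedAnchor.isMorphism [IsManifold 𝓘(ℝ, E) ∞ M] [IsManifold 𝓘(ℝ, E') ∞ N]
    [CompleteSpace F'] (hφ : ∀ y : N, Manifold.IsImmersionAt 𝓘(ℝ, E') 𝓘(ℝ, E) ∞ φ y)
    (hP : B.IsMorphism P) (hR : IsRestrictedAnchor B P B' P' φ) : B'.IsMorphism P' := by
  intro e' he'
  have hfib : ∀ p ∈ e'.target, ∀ v, B'.covector e' (e'.symm p) v ∈ B'.fiber (e'.symm p) :=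
    fun p hp v => covector_mem_fiber he' (e'.map_target hp) v
  -- At this stage `L p` is only linear. Its continuity is deduced from its action on smooth
  -- sections with variable coordinates.
  have hex : ∀ p, ∃ L : F' →ₗ[ℝ] E', p ∈ e'.target → ∀ v (h : B'.covector e' (e'.symm p) v ∈
      B'.fiber (e'.symm p)), L v = mvfderiv 𝓘(ℝ, E') (e' : N → E') (e'.symm p)
        (P' (e'.symm p) ⟨B'.covector e' (e'.symm p) v, h⟩) := by
    intro p
    by_cases hp : p ∈ e'.target
    · let c : F' →ₗ[ℝ] B'.fiber (e'.symm p) :=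
        { toFun := fun v => ⟨B'.covector e' (e'.symm p) v, hfib p hp v⟩
          map_add' := fun v w => Subtype.ext (by simpa using B'.covector_smul_add 1 v w)
          map_smul' := fun a v => Subtype.ext (by ext; simp [covector_apply]) }
      exact ⟨(mvfderiv 𝓘(ℝ, E') (e' : N → E') (e'.symm p)).toLinearMap ∘ₗ P' (e'.symm p) ∘ₗ c,
        fun _ v h => rfl⟩
    · exact ⟨0, fun h => absurd h hp⟩
  choose L hL using hex
  have hsm : ∀ β : E' → F', ContDiff ℝ ∞ β → ContDiffOn ℝ ∞ (fun p => L p (β p)) e'.target := by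
    intro β hβ
    have hsec := isSection_of_contDiffOn he' hβ.contDiffOn
    refine ((hR.contDiffOn_chartField hφ hP he' e'.open_source hsec).mono
      fun p hp => ⟨hp, e'.map_target hp⟩).congr fun p hp => ?_
    have hmem : B'.covector e' (e'.symm p) (β (e' (e'.symm p))) ∈ B'.fiber (e'.symm p) :=
      covector_mem_fiber he' (e'.map_target hp) _
    rw [chartField_eq hmem]
    simp only [e'.right_inv hp]
    exact hL p hp _ _
  have hcont : ∀ p ∈ e'.target, Continuous (L p) := by
    intro p hp
    -- Automatic continuity needs a direction in which to move the base point. If `E'` is zero, so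
    -- is the target of `L p`.
    rcases subsingleton_or_nontrivial E' with _ | _
    · exact continuous_of_const fun _ _ => Subsingleton.elim _ _
    · exact continuous_of_continuousOn_apply e'.open_target
        (fun β hβ => (hsm β hβ).continuousOn) hp
  have hex : ∀ p, ∃ A : F' →L[ℝ] E', p ∈ e'.target → ∀ v, A v = L p v := by
    intro p
    by_cases hp : p ∈ e'.target
    · exact ⟨⟨L p, hcont p hp⟩, fun _ _ => rfl⟩
    · exact ⟨0, fun h => absurd h hp⟩
  choose Q hQ using hex
  refine ⟨Q, contDiffOn_clm_of_forall_apply e'.open_target fun v =>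
    (hsm (fun _ => v) contDiff_const).congr fun p hp => hQ p hp v, fun y hy v h => ?_⟩
  have h1 := (hQ _ (e'.map_source hy) v).trans (hL _ (e'.map_source hy) v
    (covector_mem_fiber he' (e'.map_target (e'.map_source hy)) v))
  rw [h1]
  congr! <;> simp [e'.left_inv hy]

end RestrictedAnchor

/-! ### Stability of `𝔄` and the Jacobi identity on the submanifold -/

section RestrictedBracket

open WeakSubbundle

variable {E M F E' N F' : Type*}
  [NormedAddCommGroup E] [NormedSpace ℝ E] [TopologicalSpace M] [ChartedSpace E M]
  [NormedAddCommGroup F] [NormedSpace ℝ F]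
  [NormedAddCommGroup E'] [NormedSpace ℝ E'] [TopologicalSpace N] [ChartedSpace E' N]
  [NormedAddCommGroup F'] [NormedSpace ℝ F']
  {B : WeakSubbundle E M F} {P : B.FiberMap} {B' : WeakSubbundle E' N F'} {P' : B'.FiberMap}
  {φ : N → M} {e : OpenPartialHomeomorph M E} {e' : OpenPartialHomeomorph N E'}
  {Q : E → F →L[ℝ] E} {C : E → F →L[ℝ] F →L[ℝ] F} {U : Set N} {y : N} {f g k : N → ℝ}

theorem IsTangentLift.mono {incl : F →L[ℝ] E →L[ℝ] ℝ} {ψ : E' → E} {W W' : Set E'} {f : E' → ℝ}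
    {a : E' → F} {X : E' → E'} (h : IsTangentLift incl Q ψ W f a X) (hW : W' ⊆ W) :
    IsTangentLift incl Q ψ W' f a X :=
  ⟨h.contDiffOn.mono hW, h.contDiffOn_lift.mono hW, h.contDiffOn_field.mono hW,
    fun p hp => h.fderiv_eq p (hW hp), fun p hp => h.map_field p (hW hp)⟩

theorem WeakSubbundle.IsSection.of_locally
    {β : ∀ y : N, TangentSpace 𝓘(ℝ, E') y →L[ℝ] ℝ}
    (h : ∀ y ∈ U, ∃ V, IsOpen V ∧ y ∈ V ∧ B'.IsSection V β) : B'.IsSection U β := by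
  refine isSectionAlong_of_locally contMDiff_id fun y hy => ?_
  obtain ⟨V, hV, hyV, hs⟩ := h y hy
  obtain ⟨e', he', hye'⟩ := B'.exists_chart y
  obtain ⟨s, hs, hβ⟩ := hs e' he'
  exact ⟨V ∩ e'.source, hV.inter e'.open_source, ⟨hyV, hye'⟩, e', he', fun z hz => hz.2, s, hs, hβ⟩

theorem WeakSubbundle.InAlgebra.fderiv_comp_symm (hU : IsOpen U) (hf : B'.InAlgebra U f)
    (he' : e' ∈ B'.charts) {p : E'} (hp : p ∈ e'.target ∩ e'.symm ⁻¹' U)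
    (u : TangentSpace 𝓘(ℝ, E') (e'.symm p)) :
    mvfderiv 𝓘(ℝ, E') f (e'.symm p) u
      = fderiv ℝ (f ∘ e'.symm) p (mvfderiv 𝓘(ℝ, E') (e' : N → E') (e'.symm p) u) := by
  have := mvfderiv_eq_fderiv_comp (mem_maximalAtlas he') (e'.map_target hp.1)
    ((hf.contMDiffOn.contMDiffAt (hU.mem_nhds hp.2)).mdifferentiableAt (by simp)) u
  rwa [e'.right_inv hp.1] at this

theorem WeakSubbundle.InAlgebra.bracket_chart (hU : IsOpen U) (hf : B'.InAlgebra U f)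
    (hg : B'.InAlgebra U g) (he' : e' ∈ B'.charts) {p : E'} (hp : p ∈ e'.target ∩ e'.symm ⁻¹' U) :
    B'.bracket P' f g (e'.symm p)
      = - fderiv ℝ (f ∘ e'.symm) p (chartField P' e' (fun z => mvfderiv 𝓘(ℝ, E') g z) p) := by
  have hmem : mvfderiv 𝓘(ℝ, E') g (e'.symm p) ∈ B'.fiber (e'.symm p) :=
    hg.isSection.mem_fiber (φ := fun x => x) hp.2
  rw [bracket_eq hmem, hf.fderiv_comp_symm hU he' hp, chartField_eq hmem]

/-- The differential of a function of the algebra `𝔄` lifts locally to a tangent section. -/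
theorem IsRestrictedAnchor.exists_isTangentLift [IsManifold 𝓘(ℝ, E) ∞ M]
    [IsManifold 𝓘(ℝ, E') ∞ N] (hφ : ∀ y : N, Manifold.IsImmersionAt 𝓘(ℝ, E') 𝓘(ℝ, E) ∞ φ y)
    (hR : IsRestrictedAnchor B P B' P' φ) (he : e ∈ B.charts) (he' : e' ∈ B'.charts)
    (hQs : ContDiffOn ℝ ∞ Q e.target)
    (hQ : ∀ x ∈ e.source, ∀ v (h : B.covector e x v ∈ B.fiber x),
        mvfderiv 𝓘(ℝ, E) (e : M → E) x (P x ⟨B.covector e x v, h⟩) = Q (e x) v)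
    (hU : IsOpen U) (hf : B'.InAlgebra U f) (hy : y ∈ U) (hye' : y ∈ e'.source)
    (hye : φ y ∈ e.source) :
    ∃ W, IsOpen W ∧ e' y ∈ W ∧ W ⊆ e'.target ∩ e'.symm ⁻¹' U ∧
      (∀ p ∈ W, φ (e'.symm p) ∈ e.source) ∧ ContDiffOn ℝ ∞ (e ∘ φ ∘ e'.symm) W ∧ ∃ a : E' → F,
        IsTangentLift B.incl Q (e ∘ φ ∘ e'.symm) W (f ∘ e'.symm) a
          (chartField P' e' fun z => mvfderiv 𝓘(ℝ, E') f z) := by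
  obtain ⟨W, hW, hyW, hWU, hWe, hφW, hX, a, ha, hfa, hXa⟩ :=
    hR.exists_chart_lift hφ he he' hQs hQ hU hf.isSection hy hye' hye
  refine ⟨W, hW, hyW, hWU, hWe, hφW, a,
    (contDiffOn_comp_symm (mem_maximalAtlas he') hf.contMDiffOn).mono hWU, ha, hX,
    fun p hp w => ?_, hXa⟩
  obtain ⟨u, rfl⟩ := (mvfderiv_chart_bijective (mem_maximalAtlas he')
    (e'.map_target (hWU hp).1)).2 w
  rw [← hf.fderiv_comp_symm hU he' (hWU hp), hfa p hp]

variable {W : Set E'} {a b c : E' → F}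

theorem bracket_chart_eq_of_isTangentLift (hU : IsOpen U) (hf : B'.InAlgebra U f)
    (hg : B'.InAlgebra U g) (he' : e' ∈ B'.charts) (hWU : W ⊆ e'.target ∩ e'.symm ⁻¹' U)
    (ha : IsTangentLift B.incl Q (e ∘ φ ∘ e'.symm) W (f ∘ e'.symm) a
      (chartField P' e' fun z => mvfderiv 𝓘(ℝ, E') f z))
    (hb : IsTangentLift B.incl Q (e ∘ φ ∘ e'.symm) W (g ∘ e'.symm) b
      (chartField P' e' fun z => mvfderiv 𝓘(ℝ, E') g z)) {p : E'} (hp : p ∈ W) :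
    (B'.bracket P' f g ∘ e'.symm) p
      = - B.incl (a p) (Q ((e ∘ φ ∘ e'.symm) p) (b p)) := by
  rw [Function.comp_apply, hf.bracket_chart hU hg he' (hWU hp), ha.fderiv_eq p hp,
    hb.map_field p hp]

theorem contDiffOn_bracket_chart (hU : IsOpen U) (hf : B'.InAlgebra U f)
    (hg : B'.InAlgebra U g) (he' : e' ∈ B'.charts) (hWU : W ⊆ e'.target ∩ e'.symm ⁻¹' U)
    (hWe : ∀ p ∈ W, φ (e'.symm p) ∈ e.source) (hφW : ContDiffOn ℝ ∞ (e ∘ φ ∘ e'.symm) W)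
    (hQs : ContDiffOn ℝ ∞ Q e.target)
    (ha : IsTangentLift B.incl Q (e ∘ φ ∘ e'.symm) W (f ∘ e'.symm) a
      (chartField P' e' fun z => mvfderiv 𝓘(ℝ, E') f z))
    (hb : IsTangentLift B.incl Q (e ∘ φ ∘ e'.symm) W (g ∘ e'.symm) b
      (chartField P' e' fun z => mvfderiv 𝓘(ℝ, E') g z)) :
    ContDiffOn ℝ ∞ (B'.bracket P' f g ∘ e'.symm) W := by
  have h1 := (B.incl.contDiff.comp_contDiffOn ha.contDiffOn_lift).clm_apply
    ((hQs.comp hφW fun p hp => e.map_source (hWe p hp)).clm_apply hb.contDiffOn_lift)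
  exact h1.neg.congr fun p hp => bracket_chart_eq_of_isTangentLift hU hf hg he' hWU ha hb hp

/-- The differential of the bracket of two functions of the algebra `𝔄`. -/
theorem mvfderiv_bracket_of_isTangentLift (hQ : IsLocalPoisson B.incl e.target Q C)
    (hU : IsOpen U) (hf : B'.InAlgebra U f)
    (hg : B'.InAlgebra U g) (he' : e' ∈ B'.charts) (hW : IsOpen W)
    (hWU : W ⊆ e'.target ∩ e'.symm ⁻¹' U)
    (hWe : ∀ p ∈ W, φ (e'.symm p) ∈ e.source) (hφW : ContDiffOn ℝ ∞ (e ∘ φ ∘ e'.symm) W)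
    (ha : IsTangentLift B.incl Q (e ∘ φ ∘ e'.symm) W (f ∘ e'.symm) a
      (chartField P' e' fun z => mvfderiv 𝓘(ℝ, E') f z))
    (hb : IsTangentLift B.incl Q (e ∘ φ ∘ e'.symm) W (g ∘ e'.symm) b
      (chartField P' e' fun z => mvfderiv 𝓘(ℝ, E') g z))
    (hs : ∀ p ∈ W, MDifferentiableAt 𝓘(ℝ, E') 𝓘(ℝ, ℝ) (B'.bracket P' f g) (e'.symm p))
    {p : E'} (hp : p ∈ W) (u : TangentSpace 𝓘(ℝ, E') (e'.symm p)) :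
    mvfderiv 𝓘(ℝ, E') (B'.bracket P' f g) (e'.symm p) u
      = B.incl (bracketLift C (e ∘ φ ∘ e'.symm) a b
          (chartField P' e' fun z => mvfderiv 𝓘(ℝ, E') f z)
          (chartField P' e' fun z => mvfderiv 𝓘(ℝ, E') g z) p)
        (fderiv ℝ (e ∘ φ ∘ e'.symm) p
          (mvfderiv 𝓘(ℝ, E') (e' : N → E') (e'.symm p) u)) := by
  have h1 := mvfderiv_eq_fderiv_comp (mem_maximalAtlas he') (e'.map_target (hWU hp).1) (hs p hp) u
  rw [e'.right_inv (hWU hp).1] at h1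
  have hev : B'.bracket P' f g ∘ e'.symm
      =ᶠ[𝓝 p] fun q => - B.incl (a q) (Q ((e ∘ φ ∘ e'.symm) q) (b q)) :=
    Filter.eventuallyEq_of_mem (hW.mem_nhds hp) fun q hq =>
      bracket_chart_eq_of_isTangentLift hU hf hg he' hWU ha hb hq
  rw [h1, hev.fderiv_eq]
  exact hQ.fderiv_bracket hW hφW (fun q hq => e.map_source (hWe q hq)) ha hb hp _

/-- Locally the bracket is `-⟨a, Q b⟩` for smooth lifts. This is established first because the
formula for its differential presupposes differentiability. -/
theorem IsRestrictedAnchor.contMDiffOn_bracket [IsManifold 𝓘(ℝ, E) ∞ M]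
    [IsManifold 𝓘(ℝ, E') ∞ N] (hφ : ∀ y : N, Manifold.IsImmersionAt 𝓘(ℝ, E') 𝓘(ℝ, E) ∞ φ y)
    (hP : B.IsMorphism P) (hR : IsRestrictedAnchor B P B' P' φ) (hU : IsOpen U)
    (hf : B'.InAlgebra U f) (hg : B'.InAlgebra U g) :
    ContMDiffOn 𝓘(ℝ, E') 𝓘(ℝ, ℝ) ∞ (B'.bracket P' f g) U := by
  intro y hy
  obtain ⟨e', he', hye'⟩ := B'.exists_chart y
  obtain ⟨e, he, hye⟩ := B.exists_chart (φ y)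
  obtain ⟨Q, hQs, hQ⟩ := hP e he
  obtain ⟨W₁, hW₁, hyW₁, hWU₁, hWe₁, hφW₁, a, ha⟩ :=
    hR.exists_isTangentLift hφ he he' hQs hQ hU hf hy hye' hye
  obtain ⟨W₂, hW₂, hyW₂, -, -, -, b, hb⟩ :=
    hR.exists_isTangentLift hφ he he' hQs hQ hU hg hy hye' hye
  have hl : W₁ ∩ W₂ ⊆ W₁ := Set.inter_subset_left
  have h1 := contMDiffOn_comp_chart (mem_maximalAtlas he') (contDiffOn_bracket_chart hU hf hg he'
    (hl.trans hWU₁) (fun p hp => hWe₁ p hp.1) (hφW₁.mono hl) hQs (ha.mono hl)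
    (hb.mono Set.inter_subset_right))
  have hV : IsOpen (e'.source ∩ e' ⁻¹' (W₁ ∩ W₂)) := e'.isOpen_inter_preimage (hW₁.inter hW₂)
  have h2 : ContMDiffOn 𝓘(ℝ, E') 𝓘(ℝ, ℝ) ∞ (B'.bracket P' f g) (e'.source ∩ e' ⁻¹' (W₁ ∩ W₂)) :=
    h1.congr fun z hz => by simp [e'.left_inv hz.1]
  exact (h2.contMDiffAt (hV.mem_nhds ⟨hye', hyW₁, hyW₂⟩)).contMDiffWithinAt

/-- The algebra `𝔄` is stable under the bracket of the restricted anchor. -/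
theorem IsRestrictedAnchor.bracket_mem [IsManifold 𝓘(ℝ, E) ∞ M] [IsManifold 𝓘(ℝ, E') ∞ N]
    [CompleteSpace F] (hφ : ∀ y : N, Manifold.IsImmersionAt 𝓘(ℝ, E') 𝓘(ℝ, E) ∞ φ y)
    (hP : B.IsPoissonAnchor P) (hB' : IsRestriction B B' φ)
    (hR : IsRestrictedAnchor B P B' P' φ) (hU : IsOpen U)
    (hf : B'.InAlgebra U f) (hg : B'.InAlgebra U g) : B'.InAlgebra U (B'.bracket P' f g) := by
  have hφs := contMDiff_of_isImmersionAt hφ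
  have hs := hR.contMDiffOn_bracket hφ hP.isMorphism hU hf hg
  refine (inAlgebra_iff hU).2 ⟨hs, IsSection.of_locally fun y hy => ?_⟩
  obtain ⟨e', he', hye'⟩ := B'.exists_chart y
  obtain ⟨e, he, hye⟩ := B.exists_chart (φ y)
  obtain ⟨Q, C, hQC, hQ⟩ := hP.exists_isLocalPoisson he
  obtain ⟨W₁, hW₁, hyW₁, hWU₁, hWe₁, hφW₁, a, ha⟩ :=
    hR.exists_isTangentLift hφ he he' hQC.contDiffOn hQ hU hf hy hye' hye
  obtain ⟨W₂, hW₂, hyW₂, -, -, -, b, hb⟩ :=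
    hR.exists_isTangentLift hφ he he' hQC.contDiffOn hQ hU hg hy hye' hye
  have hl : W₁ ∩ W₂ ⊆ W₁ := Set.inter_subset_left
  have hW := hW₁.inter hW₂
  have ha' := ha.mono hl
  have hb' := hb.mono (Set.inter_subset_right (s := W₁))
  have hO : Set.MapsTo (e ∘ φ ∘ e'.symm) (W₁ ∩ W₂) e.target :=
    fun p hp => e.map_source (hWe₁ p hp.1)
  have hd := fun p hp => mvfderiv_bracket_of_isTangentLift hQC hU hf hg he' hW (hl.trans hWU₁)
    (fun p hp => hWe₁ p hp.1) (hφW₁.mono hl) ha' hb' (fun p hp =>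
      (hs.contMDiffAt (hU.mem_nhds (hWU₁ hp.1).2)).mdifferentiableAt (by simp)) (p := p) hp
  have hγ := IsTangentLift.contDiffOn_bracketLift hQC.contDiffOn_deriv hW (hφW₁.mono hl) hO ha' hb'
  set γ := bracketLift C (e ∘ φ ∘ e'.symm) a b
    (chartField P' e' fun z => mvfderiv 𝓘(ℝ, E') f z)
    (chartField P' e' fun z => mvfderiv 𝓘(ℝ, E') g z)
  let V : Set N := e'.source ∩ e' ⁻¹' (W₁ ∩ W₂)
  have hV : IsOpen V := e'.isOpen_inter_preimage hW
  have hVe : ∀ z ∈ V, φ z ∈ e.source := fun z hz => by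
    have := hWe₁ _ hz.2.1
    rwa [e'.left_inv hz.1] at this
  -- The bracket lift is a form along `φ` with values in `T♭M`, so its restriction, which is
  -- `d{f,g}`, is a section of `T♭N`.
  have hsec : B.IsSectionAlong (E' := E') φ V fun z => B.covector e (φ z) (γ (e' z)) :=
    isSectionAlong_of_locally hφs fun z hz => ⟨V, hV, hz, e, he, hVe, fun z => γ (e' z),
      contMDiffOn_comp_chart (mem_maximalAtlas he') hγ, fun _ _ => rfl⟩
  refine ⟨V, hV, ⟨hye', hyW₁, hyW₂⟩, IsSectionAlong.congr (hB'.1 V hV _ hsec) fun z hz => ?_⟩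
  ext u
  have h1 := hd (e' z) hz.2
  rw [e'.left_inv hz.1] at h1
  refine (h1 u).trans ?_
  rw [← mvfderiv_chart_mfderiv (mem_maximalAtlas he) (mem_maximalAtlas he')
    ((hφs z).mdifferentiableAt (by simp)) hz.1 (hVe z hz)]
  rfl

/-- The bracket of the restricted anchor satisfies the Jacobi identity. -/
theorem IsRestrictedAnchor.jacobi [IsManifold 𝓘(ℝ, E) ∞ M] [IsManifold 𝓘(ℝ, E') ∞ N]
    [CompleteSpace F] (hφ : ∀ y : N, Manifold.IsImmersionAt 𝓘(ℝ, E') 𝓘(ℝ, E) ∞ φ y)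
    (hP : B.IsPoissonAnchor P) (hB' : IsRestriction B B' φ)
    (hR : IsRestrictedAnchor B P B' P' φ) (hU : IsOpen U)
    (hf : B'.InAlgebra U f) (hg : B'.InAlgebra U g) (hk : B'.InAlgebra U k) (hy : y ∈ U) :
    B'.bracket P' f (B'.bracket P' g k) y + B'.bracket P' g (B'.bracket P' k f) y
      + B'.bracket P' k (B'.bracket P' f g) y = 0 := by
  obtain ⟨e', he', hye'⟩ := B'.exists_chart y
  obtain ⟨e, he, hye⟩ := B.exists_chart (φ y)
  obtain ⟨Q, C, hQC, hQ⟩ := hP.exists_isLocalPoisson he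
  obtain ⟨W₁, hW₁, hyW₁, hWU₁, hWe₁, hφW₁, a, ha⟩ :=
    hR.exists_isTangentLift hφ he he' hQC.contDiffOn hQ hU hf hy hye' hye
  obtain ⟨W₂, hW₂, hyW₂, -, -, -, b, hb⟩ :=
    hR.exists_isTangentLift hφ he he' hQC.contDiffOn hQ hU hg hy hye' hye
  obtain ⟨W₃, hW₃, hyW₃, -, -, -, c, hc⟩ :=
    hR.exists_isTangentLift hφ he he' hQC.contDiffOn hQ hU hk hy hye' hye
  let W := W₁ ∩ (W₂ ∩ W₃)
  have hW : IsOpen W := hW₁.inter (hW₂.inter hW₃)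
  have hyW : e' y ∈ W := ⟨hyW₁, hyW₂, hyW₃⟩
  have hl : W ⊆ W₁ := Set.inter_subset_left
  have ha' := ha.mono hl
  have hb' := hb.mono (W' := W) fun p hp => hp.2.1
  have hc' := hc.mono (W' := W) fun p hp => hp.2.2
  have hO : Set.MapsTo (e ∘ φ ∘ e'.symm) W e.target := fun p hp => e.map_source (hWe₁ p hp.1)
  -- The minus sign of the outer bracket is absorbed by antisymmetry of `P'`: it becomes `d{f₂,f₃}`
  -- on the field of `f₁`, whose image under the differential of `φ` in charts is `Q a₁`.
  have key : ∀ {f₁ f₂ f₃ : N → ℝ} {a₁ a₂ a₃ : E' → F}, B'.InAlgebra U f₁ → B'.InAlgebra U f₂ →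
      B'.InAlgebra U f₃ →
      IsTangentLift B.incl Q (e ∘ φ ∘ e'.symm) W (f₁ ∘ e'.symm) a₁
        (chartField P' e' fun z => mvfderiv 𝓘(ℝ, E') f₁ z) →
      IsTangentLift B.incl Q (e ∘ φ ∘ e'.symm) W (f₂ ∘ e'.symm) a₂
        (chartField P' e' fun z => mvfderiv 𝓘(ℝ, E') f₂ z) →
      IsTangentLift B.incl Q (e ∘ φ ∘ e'.symm) W (f₃ ∘ e'.symm) a₃
        (chartField P' e' fun z => mvfderiv 𝓘(ℝ, E') f₃ z) →
      B'.bracket P' f₁ (B'.bracket P' f₂ f₃) y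
        = B.incl (bracketLift C (e ∘ φ ∘ e'.symm) a₂ a₃
            (chartField P' e' fun z => mvfderiv 𝓘(ℝ, E') f₂ z)
            (chartField P' e' fun z => mvfderiv 𝓘(ℝ, E') f₃ z) (e' y))
          (Q ((e ∘ φ ∘ e'.symm) (e' y)) (a₁ (e' y))) := by
    intro f₁ f₂ f₃ a₁ a₂ a₃ h₁ h₂ h₃ l₁ l₂ l₃
    have hbr := hR.bracket_mem hφ hP hB' hU h₂ h₃
    have hm₁ : mvfderiv 𝓘(ℝ, E') f₁ y ∈ B'.fiber y := h₁.isSection.mem_fiber (φ := fun x => x) hy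
    have hm : mvfderiv 𝓘(ℝ, E') (B'.bracket P' f₂ f₃) y ∈ B'.fiber y :=
      hbr.isSection.mem_fiber (φ := fun x => x) hy
    have hanti := hR.isAntisymm hP.isAntisymm y ⟨_, hm⟩ ⟨_, hm₁⟩
    have hd := mvfderiv_bracket_of_isTangentLift hQC hU h₂ h₃ he' hW (hl.trans hWU₁)
      (fun p hp => hWe₁ p hp.1) (hφW₁.mono hl) l₂ l₃ (fun p hp =>
      (hbr.contMDiffOn.contMDiffAt (hU.mem_nhds (hWU₁ hp.1).2)).mdifferentiableAt (by simp)) hyW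
    have hX := l₁.map_field _ hyW
    have hm₁' : mvfderiv 𝓘(ℝ, E') f₁ (e'.symm (e' y)) ∈ B'.fiber (e'.symm (e' y)) := by
      rwa [e'.left_inv hye']
    rw [chartField_eq hm₁'] at hX
    rw [bracket_eq hm, ← hanti, ← hX]
    -- Transport along `e'.symm (e' y) = y`, since the fibres depend on the base point.
    have hd' : ∀ z, e'.symm (e' y) = z → ∀ hz : mvfderiv 𝓘(ℝ, E') f₁ z ∈ B'.fiber z,
        mvfderiv 𝓘(ℝ, E') (B'.bracket P' f₂ f₃) z (P' z ⟨_, hz⟩)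
          = mvfderiv 𝓘(ℝ, E') (B'.bracket P' f₂ f₃) (e'.symm (e' y)) (P' _ ⟨_, hm₁'⟩) := by
      rintro _ rfl hz
      rfl
    exact (hd' y (e'.left_inv hye') hm₁).trans (hd _)
  rw [key hf hg hk ha' hb' hc', key hg hk hf hb' hc' ha', key hk hf hg hc' ha' hb']
  exact hQC.jacobi_bracketLift hW (hφW₁.mono hl) hO ha' hb' hc' hyW

/-- The restricted anchor is a partial Poisson anchor. -/
theorem IsRestrictedAnchor.isPoissonAnchor [IsManifold 𝓘(ℝ, E) ∞ M] [IsManifold 𝓘(ℝ, E') ∞ N]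
    [CompleteSpace F] [CompleteSpace F']
    (hφ : ∀ y : N, Manifold.IsImmersionAt 𝓘(ℝ, E') 𝓘(ℝ, E) ∞ φ y)
    (hP : B.IsPoissonAnchor P) (hB' : IsRestriction B B' φ)
    (hR : IsRestrictedAnchor B P B' P' φ) : B'.IsPoissonAnchor P' where
  isMorphism := hR.isMorphism hφ hP.isMorphism
  isAntisymm := hR.isAntisymm hP.isAntisymm
  bracket_mem _ hU _ _ hf hg := hR.bracket_mem hφ hP hB' hU hf hg
  jacobi _ hU _ _ _ hf hg hk _ hy := hR.jacobi hφ hP hB' hU hf hg hk hy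

end RestrictedBracket

end PartialPoisson

end

theorem mainTheorem6 {E M F E' N F' : Type*}
    [NormedAddCommGroup E] [NormedSpace ℝ E] [CompleteSpace E]
    [TopologicalSpace M] [ChartedSpace E M] [IsManifold 𝓘(ℝ, E) ∞ M]
    [NormedAddCommGroup F] [NormedSpace ℝ F] [CompleteSpace F]
    [NormedAddCommGroup E'] [NormedSpace ℝ E'] [CompleteSpace E']
    [TopologicalSpace N] [ChartedSpace E' N] [IsManifold 𝓘(ℝ, E') ∞ N]
    [NormedAddCommGroup F'] [NormedSpace ℝ F'] [CompleteSpace F']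
    (B : PartialPoisson.WeakSubbundle E M F) (P : B.FiberMap) (hP : B.IsPoissonAnchor P)
    (φ : N → M) (hφ : ∀ y : N, Manifold.IsImmersionAt 𝓘(ℝ, E') 𝓘(ℝ, E) ∞ φ y)
    (hφ_inj : Function.Injective φ)
    (B' : PartialPoisson.WeakSubbundle E' N F') (hB' : PartialPoisson.IsRestriction B B' φ)
    (h1 : PartialPoisson.RpP1 (E' := E') B P φ) (h2 : PartialPoisson.RpP2 (E' := E') B P φ) :
    ∃! P' : B'.FiberMap,
      B'.IsPoissonAnchor P' ∧ PartialPoisson.IsRestrictedAnchor B P B' P' φ := by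
  obtain ⟨P', hR⟩ := PartialPoisson.exists_isRestrictedAnchor hφ hB' h1 h2
  -- Uniqueness comes from the restriction identity alone.
  exact ⟨P', ⟨hR.isPoissonAnchor hφ hP hB', hR⟩, fun _ h => h.2.unique hφ hR⟩
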